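/- Let $k$ be a field of characteristic $0$, let $n\ge 0$ and let $\beta_0,\beta_1,\beta_2,\dots\in k$ be arbitrary parameters. **The algebra $\mathcal R_n$.** Let $\mathfrak{su}(1,1)$ be the Lie algebra over $k$ with basis $J_0,J_+,J_-$ and $[J_0,J_\pm]=\pm J_\pm$, $[J_-,J_+]=2J_0$. In $\mathcal U(\mathfrak{su}(1,1))^{\otimes n}$ put, for $K\subset\{1,\dots,n\}$, $J_{\epsilon,K}=\sum_{i\in K}J_{\epsilon,i}$ (with $J_{\epsilon,i}$ being $J_\epsilon$ in the $i$-th tensor factor) and $C_K=J_{0,K}^2-J_{0,K}-J_{+,K}J_{-,K}$. The higher rank Racah algebra $\mathcal R_n$ is the $k$-subalgebra generated by all $C_K$, $K\ne\emptyset$. Write $[p..q]=\{p,\dots,q\}$ and $[m]=[1..m]$. **The difference operators.** Consider operators on the field $k(x_1,x_2,\dots)$ of rational functions, and let $E_{x_i}$ be the automorphism $x_i\mapsto x_i+1$ fixing the other variables. Define $$\mathcal L_j=\sum_{0\ne\nu\in\{-1,0,1\}^j}G_\nu\,(E_{x_1}^{\nu_1}\cdots E_{x_j}^{\nu_j}-1),\qquad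 G_\nu=2^{\#\{i:\nu_i=0\}}\,\frac{\prod_{i=0}^{j}B_i^{\nu_i,\nu_{i+1}}}{\prod_{i=1}^{j}b_i^{\nu_i}},\qquad \nu_0=\nu_{j+1}=0,$$ where $B_i^{0,0}=x_i(x_i+\beta_i)+x_{i+1}(x_{i+1}+\beta_{i+1})+\tfrac12(\beta_i+1)(\beta_{i+1}-1)$, $B_i^{0,1}=(x_{i+1}+x_i+\beta_{i+1})(x_{i+1}-x_i+\beta_{i+1}-\beta_i)$, $B_i^{1,0}=(x_{i+1}-x_i)(x_{i+1}+x_i+\beta_{i+1})$, $B_i^{1,1}=(x_{i+1}+x_i+\beta_{i+1})(x_{i+1}+x_i+\beta_{i+1}+1)$, $b_i^0=(2x_i+\beta_i+1)(2x_i+\beta_i-1)$, $b_i^1=(2x_i+\beta_i+1)(2x_i+\beta_i)$, and an upper index $-1$ in the first (second) position of $B_i$ is obtained from the index $1$ by $x_i\mapsto -x_i-\beta_i$ (respectively $x_{i+1}\mapsto -x_{i+1}-\beta_{i+1}$), and in $b_i$ by $x_i\mapsto-x_i-\beta_i$. Let $\kappa(x,\beta)=\left(x+\frac{\beta+1}{2}\right)\left(x+\frac{\beta-1}{2}\right)$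 and put $$\widehat C_{[m]}=\kappa(x_{m-1},\beta_{m-1})\quad(1\le m\le n),\qquad \widehat C_{[2..m+1]}=-\mathcal L_{m-1}+\kappa(0,\beta_m-\beta_0-1)\quad(1\le m\le n-1),$$ $$\widehat C_{[p..q]}=\sigma^{p-2}\bigl(\widehat C_{[2..q-p+2]}\bigr)\quad(2<p\le q\le n),$$ where $\sigma$ raises every index of the symbols $x_i,\beta_i,E_{x_i}$ in the expression by $1$, and where $x_0=0$ is substituted in the resulting operators. **Claim.** These operators generate a discrete realization of $\mathcal R_n$: there is a homomorphism of unital $k$-algebras $\varphi$ from $\mathcal R_n$ to the $k$-linear endomorphisms of $k(x_1,x_2,\dots)$ with $\varphi(C_{[m]})=\widehat C_{[m]}$ for $1\le m\le n$ and $\varphi(C_{[p..q]})=\widehat C_{[p..q]}$ for $2\le p\le q\le n$, and its image is exactly the algebra generated by these operators. It acts on the multivariate Racah polynomials: for $s_1,\dots,s_{n-2}\in\mathbb N$ put $|s|_j=s_1+\dots+s_j$ and $$R_s=\prod_{j=1}^{n-2} r_{s_j}\bigl(2|s|_{j-1}+\beta_j-\beta_0-1,\ \beta_{j+1}-\beta_j-1,\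 |s|_{j-1}-x_{j+1}-1,\ |s|_{j-1}+\beta_j+x_{j+1};\ -|s|_{j-1}+x_j\bigr),$$ where $r_N(\alpha,\beta,\gamma,\delta;x)=(\alpha+1)_N(\beta+\delta+1)_N(\gamma+1)_N\;{}_4F_3\!\left[{-N,\ N+\alpha+\beta+1,\ -x,\ x+\gamma+\delta+1\atop \alpha+1,\ \beta+\delta+1,\ \gamma+1};1\right]$, read as a polynomial in all its arguments by writing $(a)_N/(a)_l=(a+l)_{N-l}$. Then for $1\le m\le n-1$ $$\varphi(C_{[2..m+1]})\,R_s=\kappa\bigl(|s|_{m-1},\,\beta_m-\beta_0-1\bigr)\,R_s .$$ -/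

import Mathlib

open scoped TensorProduct

noncomputable section

namespace RacahRealization

/-! ### The Lie algebra `su(1,1)` and the higher rank Racah algebra -/

section Algebra

variable (k : Type*) [Field k]

/-- `su(1,1)` over `k`: the three-dimensional Lie algebra with basis `J₀, J₊, J₋` and brackets
`[J₀, J₊] = J₊`, `[J₀, J₋] = -J₋`, `[J₋, J₊] = 2 J₀`, realized on traceless `2 × 2` matrices
(see `su11_relations` and `su11_basis`). -/
abbrev su11 : Type _ := LieAlgebra.SpecialLinear.sl (Fin 2) k

/-- `J₀ = diag(1/2, -1/2)`. -/
def J0 : su11 k :=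
  (1 / 2 : k) • LieAlgebra.SpecialLinear.singleSubSingle (0 : Fin 2) 1 (1 : k)

/-- `J₊`, the matrix unit in position `(0, 1)`. -/
def Jp : su11 k :=
  LieAlgebra.SpecialLinear.single (0 : Fin 2) 1 (by decide) (1 : k)

/-- `J₋`, minus the matrix unit in position `(1, 0)`. -/
def Jm : su11 k :=
  -LieAlgebra.SpecialLinear.single (1 : Fin 2) 0 (by decide) (1 : k)

theorem su11_relations [CharZero k] :
    ⁅J0 k, Jp k⁆ = Jp k ∧ ⁅J0 k, Jm k⁆ = -Jm k ∧ ⁅Jm k, Jp k⁆ = (2 : k) • J0 k := by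
  refine ⟨?_, ?_, ?_⟩ <;>
  · apply Subtype.ext
    ext i j
    rw [LieAlgebra.SpecialLinear.sl_bracket]
    fin_cases i <;> fin_cases j <;>
      simp [J0, Jp, Jm, Matrix.mul_apply, Fin.sum_univ_two] <;> norm_num

/-- `J₀, J₊, J₋` form a basis: every element is a unique linear combination of them. -/
theorem su11_basis [CharZero k] (A : su11 k) :
    ∃! c : k × k × k, A = c.1 • J0 k + c.2.1 • Jp k + c.2.2 • Jm k := by
  have htr : A.val 0 0 + A.val 1 1 = 0 := by
    have h := A.property
    have h2 : Matrix.trace A.val = 0 := by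
      simpa [LieAlgebra.SpecialLinear.sl, LinearMap.mem_ker] using h
    simpa [Matrix.trace, Fin.sum_univ_two] using h2
  refine ⟨(2 * A.val 0 0, A.val 0 1, -A.val 1 0), ?_, ?_⟩
  · apply Subtype.ext
    ext i j
    fin_cases i <;> fin_cases j <;> simp [J0, Jp, Jm]
    · ring
    · linear_combination htr
  · rintro ⟨a, b, c⟩ h
    subst h
    simp [J0, Jp, Jm]
    ring

/-- The universal enveloping algebra `U(su(1,1))`. -/
abbrev U : Type _ := UniversalEnvelopingAlgebra k (su11 k)

/-- The `n`-fold tensor power `U(su(1,1))^{⊗ n}`. -/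
abbrev UTensor (n : ℕ) : Type _ := ⨂[k] _ : Fin n, U k

variable {k} {n : ℕ}

/-- `J_K = ∑_{i ∈ K} 1 ⊗ ⋯ ⊗ J ⊗ ⋯ ⊗ 1` (with `J` in position `i`), for `J` in `su(1,1)`. -/
def JSum (J : su11 k) (K : Finset (Fin n)) : UTensor k n :=
  ∑ i ∈ K, PiTensorProduct.singleAlgHom (R := k) (A := fun _ : Fin n => U k) i
    (UniversalEnvelopingAlgebra.ι k J)

/-- The intermediate Casimir element `C_K = J_{0,K}² - J_{0,K} - J_{+,K} J_{-,K}`. -/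
def casimir (K : Finset (Fin n)) : UTensor k n :=
  JSum (J0 k) K ^ 2 - JSum (J0 k) K - JSum (Jp k) K * JSum (Jm k) K

variable (k n) in
/-- The higher rank Racah algebra `R_n`: the subalgebra of `U(su(1,1))^{⊗ n}` generated by
all `C_K` with `K` non-empty. -/
def racahAlgebra : Subalgebra k (UTensor k n) :=
  Algebra.adjoin k {c | ∃ K : Finset (Fin n), K.Nonempty ∧ c = casimir K}

theorem casimir_mem (K : Finset (Fin n)) : (casimir K : UTensor k n) ∈ racahAlgebra k n := by
  rcases K.eq_empty_or_nonempty with rfl | h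
  · simp [casimir, JSum]
  · exact Algebra.subset_adjoin ⟨K, h, rfl⟩

/-- `C_K` as an element of `R_n`. -/
def gen (K : Finset (Fin n)) : racahAlgebra k n := ⟨casimir K, casimir_mem K⟩

/-- The interval `[p..q] = {p, p + 1, …, q}` of `{1, …, n}`; the factors of the tensor power are
numbered from `1` in the mathematics and from `0` in `Fin n`. -/
def interval (n p q : ℕ) : Finset (Fin n) :=
  Finset.univ.filter fun i => p ≤ (i : ℕ) + 1 ∧ (i : ℕ) + 1 ≤ q

end Algebra

/-! ### Racah operators, as expressions in families `x_i`, `β_i`, `E_{x_i}` -/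

section Expressions

variable {k : Type*} [Field k] {F : Type*} [Field F] [Algebra k F]

/-- `κ(x, β) = (x + (β + 1)/2) (x + (β - 1)/2)`. -/
def kappa (x β : F) : F := (x + (β + 1) / 2) * (x + (β - 1) / 2)

/-- `B_i^{s,t}` for `s, t ∈ {0, 1}` (only whether an index is `0` matters here), with
`x = x_i`, `y = x_{i+1}`, `b = β_i`, `c = β_{i+1}`. -/
def BNonneg (s t : SignType) (x y b c : F) : F :=
  match s, t with
  | .zero, .zero => x * (x + b) + y * (y + c) + (b + 1) * (c - 1) / 2
  | .zero, _ => (y + x + c) * (y - x + c - b)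
  | _, .zero => (y - x) * (y + x + c)
  | _, _ => (y + x + c) * (y + x + c + 1)

/-- `B_i^{s,t}` for `s, t ∈ {-1, 0, 1}`: an index `-1` is obtained from the index `1` by
the substitution `x_i ↦ -x_i - β_i` (for `s`), resp. `x_{i+1} ↦ -x_{i+1} - β_{i+1}` (for `t`). -/
def B (s t : SignType) (x y b c : F) : F :=
  BNonneg s t (if s = -1 then -x - b else x) (if t = -1 then -y - c else y) b c

/-- `b_i^s` for `s ∈ {-1, 0, 1}` with `x = x_i`, `b = β_i`; again `-1` is obtained from `1` by
`x_i ↦ -x_i - β_i`. -/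
def bFactor (s : SignType) (x b : F) : F :=
  match s with
  | .zero => (2 * x + b + 1) * (2 * x + b - 1)
  | .pos => (2 * x + b + 1) * (2 * x + b)
  | .neg => (2 * (-x - b) + b + 1) * (2 * (-x - b) + b)

/-- `ν = (ν_1, …, ν_j)` extended by `ν_0 = ν_{j+1} = 0`. -/
def extNu {j : ℕ} (ν : Fin j → SignType) (i : ℕ) : SignType :=
  if h : 1 ≤ i ∧ i ≤ j then ν ⟨i - 1, by omega⟩ else 0

/-- `G_ν = 2^{|ν|_0} ∏_{i=0}^{j} B_i^{ν_i,ν_{i+1}} / ∏_{i=1}^{j} b_i^{ν_i}`. -/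
def G (x β : ℕ → F) {j : ℕ} (ν : Fin j → SignType) : F :=
  2 ^ (Finset.univ.filter fun i => ν i = 0).card *
    (∏ i ∈ Finset.range (j + 1),
      B (extNu ν i) (extNu ν (i + 1)) (x i) (x (i + 1)) (β i) (β (i + 1))) /
    ∏ i ∈ Finset.Icc 1 j, bFactor (extNu ν i) (x i) (β i)

/-- `E_ν = E_{x_1}^{ν_1} ⋯ E_{x_j}^{ν_j}`. -/
def shiftBy (E : ℕ → F ≃ₐ[k] F) {j : ℕ} (ν : Fin j → SignType) : F ≃ₐ[k] F :=
  (List.ofFn fun i : Fin j => E ((i : ℕ) + 1) ^ ((ν i : SignType) : ℤ)).prod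

/-- Multiplication by `f`, as an operator. -/
def mulOp (k : Type*) [Field k] {F : Type*} [Field F] [Algebra k F] (f : F) : Module.End k F :=
  LinearMap.mulLeft k f

/-- The Racah operator `L_j = ∑_{ν ≠ 0} G_ν (E_ν - 1)`. -/
def racahL (x β : ℕ → F) (E : ℕ → F ≃ₐ[k] F) (j : ℕ) : Module.End k F :=
  ∑ ν ∈ Finset.univ.filter (fun ν : Fin j → SignType => ν ≠ 0),
    mulOp k (G x β ν) * ((shiftBy E ν).toLinearMap - 1)

/-- `-L_{m-1} + κ(0, β_m - β_0 - 1)`, the expression for `C_{[2..m+1]}`. -/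
def opTwo (x β : ℕ → F) (E : ℕ → F ≃ₐ[k] F) (m : ℕ) : Module.End k F :=
  -racahL x β E (m - 1) + mulOp k (kappa 0 (β m - β 0 - 1))

/-- `σ^s` on the symbols of an expression: every index is raised by `s`. -/
def sigma (s : ℕ) {α : Type*} (f : ℕ → α) : ℕ → α := fun i => f (i + s)

/-- The Racah polynomial `r_n(α, β, γ, δ; x) =
(α+1)_n (β+δ+1)_n (γ+1)_n ₄F₃(-n, n+α+β+1, -x, x+γ+δ+1; α+1, β+δ+1, γ+1; 1)`.
In the `l`-th term the quotient `(a)_n / (a)_l` is written as the polynomial `(a+l)_{n-l}`. -/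
def racahPoly (n : ℕ) (α β γ δ x : F) : F :=
  let poch : F → ℕ → F := fun a m => (ascPochhammer F m).eval a
  ∑ l ∈ Finset.range (n + 1),
    poch (-n) l * poch (n + α + β + 1) l * poch (-x) l * poch (x + γ + δ + 1) l / l.factorial *
      (poch (α + 1 + l) (n - l) * poch (β + δ + 1 + l) (n - l) * poch (γ + 1 + l) (n - l))

/-- `|s|_j = s_1 + ⋯ + s_j`. -/
def partialSum (s : ℕ → ℕ) (j : ℕ) : ℕ := ∑ i ∈ Finset.Icc 1 j, s i

/-- The multivariate (Tratnik) Racah polynomial of degrees `s_1, …, s_{n-2}` in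
`x_1, …, x_{n-2}`, with end point `x_{n-1}`:
`∏_{j=1}^{n-2} r_{s_j}(2|s|_{j-1} + β_j - β_0 - 1, β_{j+1} - β_j - 1, |s|_{j-1} - x_{j+1} - 1,
|s|_{j-1} + β_j + x_{j+1}; -|s|_{j-1} + x_j)`. -/
def multiRacah (n : ℕ) (x β : ℕ → F) (s : ℕ → ℕ) : F :=
  ∏ j ∈ Finset.Icc 1 (n - 2),
    racahPoly (s j)
      (2 * (partialSum s (j - 1) : F) + β j - β 0 - 1)
      (β (j + 1) - β j - 1)
      ((partialSum s (j - 1) : F) - x (j + 1) - 1)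
      ((partialSum s (j - 1) : F) + β j + x (j + 1))
      (-(partialSum s (j - 1) : F) + x j)

end Expressions

/-! ### The discrete model -/

section Model

variable (k : Type*) [Field k]

/-- The field of rational functions in the variables `x_1, x_2, …` (the variable with number `0`
is never used, because `x_0` is set to `0`). -/
abbrev RatFun : Type _ := FractionRing (MvPolynomial ℕ k)

/-- `x_i`, with `x_0 = 0`. -/
def xvar (i : ℕ) : RatFun k :=
  if i = 0 then 0 else algebraMap (MvPolynomial ℕ k) (RatFun k) (MvPolynomial.X i)

/-- The automorphism `x_i ↦ x_i + 1`, `x_l ↦ x_l` (`l ≠ i`) of the polynomial ring. -/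
def polyShift (i : ℕ) : MvPolynomial ℕ k ≃ₐ[k] MvPolynomial ℕ k :=
  AlgEquiv.ofAlgHom
    (MvPolynomial.aeval fun l => MvPolynomial.X l + if l = i then 1 else 0)
    (MvPolynomial.aeval fun l => MvPolynomial.X l - if l = i then 1 else 0)
    (by ext l : 1; by_cases h : l = i <;> simp [h])
    (by ext l : 1; by_cases h : l = i <;> simp [h])

/-- The shift operator `E_{x_i}` on rational functions. -/
def shiftOp (i : ℕ) : RatFun k ≃ₐ[k] RatFun k :=
  IsFractionRing.algEquivOfAlgEquiv (polyShift k i)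

variable {k}

/-- The parameters `β_i`, as constant rational functions. -/
def param (β : ℕ → k) (i : ℕ) : RatFun k := algebraMap k (RatFun k) (β i)

/-- The operator `C_{[m]} = κ(x_{m-1}, β_{m-1})`. -/
def opInitial (β : ℕ → k) (m : ℕ) : Module.End k (RatFun k) :=
  mulOp k (kappa (xvar k (m - 1)) (param β (m - 1)))

/-- The operator `C_{[p..q]} = σ^{p-2}(C_{[2..q-p+2]})` for `p ≥ 2`; for `p = 2` it is
`C_{[2..m+1]}` with `m = q - 1`. -/
def opInterval (β : ℕ → k) (p q : ℕ) : Module.End k (RatFun k) :=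
  opTwo (sigma (p - 2) (xvar k)) (sigma (p - 2) (param β)) (sigma (p - 2) (shiftOp k))
    (q - p + 1)

/-- The algebra generated by the operators `C_{[m]}`, `1 ≤ m ≤ n`, and `C_{[p..q]}`,
`2 ≤ p ≤ q ≤ n`. -/
def discreteAlgebra (n : ℕ) (β : ℕ → k) : Subalgebra k (Module.End k (RatFun k)) :=
  Algebra.adjoin k
    ({D | ∃ m, 1 ≤ m ∧ m ≤ n ∧ D = opInitial β m} ∪
      {D | ∃ p q, 2 ≤ p ∧ p ≤ q ∧ q ≤ n ∧ D = opInterval β p q})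

end Model

end RacahRealization

end

/-! The homomorphism is built on the whole tensor power. In the symmetric coordinates X_i = x_i +
β_i/2 there are operators T_0, …, T_{n-1} (`HalfShifts.total`), with T_l in the role of the
generators of the first l + 1 factors, such that T_m acts on T_l by the adjoint action whenever l ≤
m (`HalfShifts.isVector_total`). The differences of consecutive T's then commute with each other and
each satisfies the su(1,1) brackets, so `exists_tensorHom` applies, and C_{[p..q]} goes to the
Casimir operator of a difference of two T's.

The T_l are quadratic in spinors u, d, operators that shift X_{l+1} by 1/2 and -1/2. `spinorFamily`
is linear in a parameter Z and equals u at Z = X_{l+1} - δ_l and d at Z = -X_{l+1} - δ_l. Its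
quadratic relations (`IsSpinorLevel.family_symm`, `IsSpinorLevel.family_antisymm`,
`IsSpinorLevel.family_exchange`) involve Z but no longer X_{l+1}. Hence Z = X_l and Z = -X_l,
combined with half-shifts of X_l, give spinors one level lower. T_l is the symmetric product of the
family at X_l and at -X_l - 1/2; its Casimir is X_l² - 1/4 = κ(x_l, β_l). T_{l+1} is also the
symmetric product of u and d of level l (`HalfShifts.total_succ`), which yields the adjoint action
on everything below.

For l < m the Casimir of T_m - T_l is C(T_m) + C(T_l) minus a scalar product of T_m and T_l. T_l
expands into the products ud, uu, dd of level l with coefficients of the form B/b, each of these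
into the products of level l + 1, and so on; at level m - 1 only ud pairs nontrivially with T_m. The
scalar product is therefore the sum of G_ν E_ν over all paths ν (`HalfShifts.opDot_total`).

The eigenvalue equation rests on one contiguous relation, `boundarySum_racahKernel`: summing over
ν_1 removes the first variable and replaces the boundary parameter d by d + δ_1 + N, where N is the
degree. After all variables are removed one factor a² + Y² - D² + D - 1/2 remains, and the
eigenvalue is D² - D. In degree zero this evaluates the sum of all G_ν, which is what identifies the
path sum with the Racah operator.

The image is as claimed because the mixed part of C_{K ∪ L} is biadditive, so that interval Casimirs
already span all C_K. -/

noncomputable section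

namespace RacahRealization

/-! ### Couplings, weights and the action of a boundary sum on a polynomial basis -/

section Contiguous

variable {F : Type*} [Field F]

/-- The factor `B^{s,t}` in the symmetric coordinates `X = x + b / 2`, `Y = y + c / 2`,
`δ = (c - b) / 2`. -/
def coupling (s t : SignType) (X Y δ : F) : F :=
  match s, t with
  | .zero, .zero => X ^ 2 + Y ^ 2 - δ ^ 2 + δ - 1 / 2
  | .zero, .pos => (Y + X + δ) * (Y - X + δ)
  | .zero, .neg => (-Y + X + δ) * (-Y - X + δ)
  | .pos, .zero => (Y - X - δ) * (Y + X + δ)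
  | .neg, .zero => (Y + X - δ) * (Y - X + δ)
  | .pos, .pos => (X + Y + δ) * (X + Y + δ + 1)
  | .pos, .neg => (X - Y + δ) * (X - Y + δ + 1)
  | .neg, .pos => (-X + Y + δ) * (-X + Y + δ + 1)
  | .neg, .neg => (-X - Y + δ) * (-X - Y + δ + 1)

/-- The weight `2^{[s = 0]} / b^s` in the symmetric coordinate `X = x + b / 2`. -/
def weight (s : SignType) (X : F) : F :=
  match s with
  | .zero => 2 / ((2 * X + 1) * (2 * X - 1))
  | .pos => 1 / ((2 * X + 1) * (2 * X))
  | .neg => 1 / ((-(2 * X) + 1) * -(2 * X))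

theorem B_eq_coupling [CharZero F] (s t : SignType) (x y b c : F) :
    B s t x y b c = coupling s t (x + b / 2) (y + c / 2) ((c - b) / 2) := by
  have h0 : (SignType.zero : SignType) = 0 := rfl
  have h1 : (SignType.pos : SignType) = 1 := rfl
  have h2 : (SignType.neg : SignType) = -1 := rfl
  cases s <;> cases t <;> simp [B, BNonneg, coupling] <;> ring

theorem two_div_bFactor [CharZero F] (s : SignType) (x b : F) :
    (if s = 0 then 2 else 1) / bFactor s x b = weight s (x + b / 2) := by
  have h : 2 * (x + b / 2) = 2 * x + b := by ring
  cases s <;> simp only [bFactor, weight, h]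
  · rfl
  · rw [show 2 * (-x - b) + b = -(2 * x + b) by ring, show SignType.neg = -1 from rfl]
    simp
  · rw [show SignType.pos = 1 from rfl]
    simp

/-- One common inverse `i` for all weights turns the rational identities below into polynomial
multiples of a single equation, as `linear_combination` requires. -/
theorem weight_eq {X : F} (h0 : 2 * X ≠ 0) (h1 : 2 * X + 1 ≠ 0) (h2 : 2 * X - 1 ≠ 0) :
    ∃ i : F, 2 * X * (2 * X + 1) * (2 * X - 1) * i = 1 ∧ weight 0 X = 4 * X * i ∧
      weight 1 X = (2 * X - 1) * i ∧ weight (-1) X = (2 * X + 1) * i := by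
  have h3 : -(2 * X) + 1 ≠ 0 := fun h => h2 (by linear_combination -h)
  have e : 4 * X = 2 * (2 * X) := by ring
  simp only [show weight 0 X = 2 / ((2 * X + 1) * (2 * X - 1)) from rfl,
    show weight 1 X = 1 / ((2 * X + 1) * (2 * X)) from rfl,
    show weight (-1) X = 1 / ((-(2 * X) + 1) * -(2 * X)) from rfl, e]
  generalize 2 * X = z at *
  refine ⟨(z * (z + 1) * (z - 1))⁻¹, mul_inv_cancel₀ (by simp [*]), ?_, ?_, ?_⟩
  · field_simp
  · field_simp
  · rw [div_eq_iff (mul_ne_zero h3 (neg_ne_zero.2 h0))]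
    field_simp
    ring

/-- The rising factorial `(a)_m`. -/
def poch (a : F) (m : ℕ) : F := (ascPochhammer F m).eval a

@[simp] theorem poch_zero (a : F) : poch a 0 = 1 := by simp [poch]

theorem poch_succ (a : F) (m : ℕ) : poch a (m + 1) = poch a m * (a + m) := by
  simp [poch, ascPochhammer_succ_eval]

theorem poch_succ_left (a : F) (m : ℕ) : poch a (m + 1) = a * poch (a + 1) m := by
  simp [poch, ascPochhammer_succ_left, Polynomial.eval_comp]

/-- The even polynomial `∏_{i < l} ((g + i)² - X²)`. -/
def evenPoch (g X : F) (l : ℕ) : F := poch (g - X) l * poch (g + X) l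

@[simp] theorem evenPoch_zero (g X : F) : evenPoch g X 0 = 1 := by simp [evenPoch]

theorem evenPoch_neg (g X : F) (l : ℕ) : evenPoch g (-X) l = evenPoch g X l := by
  simp [evenPoch, mul_comm, sub_eq_add_neg]

/-- The coefficient `(-N)_l (N + 2d + 2δ - 1)_l (2d + l)_{N - l} / l!` of a Racah polynomial. -/
def racahCoeff (N : ℕ) (d δ : F) (l : ℕ) : F :=
  poch (-N : F) l * poch (N + 2 * d + 2 * δ - 1) l / l.factorial * poch (2 * d + l) (N - l)

/-- The Racah polynomial in symmetric coordinates. -/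
def racahKernel (N : ℕ) (X Y a d δ : F) : F :=
  ∑ l ∈ Finset.range (N + 1),
    racahCoeff N d δ l * evenPoch (d + a) X l * evenPoch (d + a + δ + l) Y (N - l)

/-- The hypergeometric term ratio, cleared of the denominator 2d + l, which may vanish. -/
theorem racahCoeff_succ [CharZero F] (N : ℕ) (d δ : F) {l : ℕ} (hl : l < N) :
    racahCoeff N d δ (l + 1) * ((l + 1) * (2 * d + l)) =
      racahCoeff N d δ l * ((l - N) * (N + 2 * d + 2 * δ - 1 + l)) := by
  obtain ⟨m, rfl⟩ := Nat.exists_eq_add_of_lt hl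
  have e1 : l + m + 1 - l = m + 1 := by omega
  have e2 : l + m + 1 - (l + 1) = m := by omega
  have h1 : ((l.factorial : ℕ) : F) ≠ 0 := by exact_mod_cast l.factorial_ne_zero
  have h2 : (l : F) + 1 ≠ 0 := by exact_mod_cast l.succ_ne_zero
  rw [racahCoeff, racahCoeff, e1, e2, poch_succ_left (2 * d + l), poch_succ, poch_succ,
    Nat.factorial_succ]
  push_cast
  rw [show 2 * d + (l : F) + 1 = 2 * d + (l + 1) by ring]
  field_simp
  ring

theorem sum_sign {M : Type*} [AddCommMonoid M] (f : SignType → M) :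
    ∑ ν, f ν = f 0 + f (-1) + f 1 := by
  rw [show (Finset.univ : Finset SignType) = {0, -1, 1} from rfl]
  simp [add_assoc]

/-- Sum over `ν` of the boundary factor times `B^{ν,μ} / b^ν` times a shifted function. -/
def boundarySum (μ : SignType) (X Y a d δ : F) (f : F → F) : F :=
  coupling 0 0 a X d * weight 0 X * coupling 0 μ X Y δ * f X +
  coupling 0 (-1) a X d * weight (-1) X * coupling (-1) μ X Y δ * f (X - 1) +
  coupling 0 1 a X d * weight 1 X * coupling 1 μ X Y δ * f (X + 1)

variable [CharZero F]

/-- Summing out the middle point X merges the edges from a to X and from X to Y into one edge, and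
their parameters add. -/
theorem boundarySum_one (μ : SignType) {X : F} (Y a d δ : F) (h0 : 2 * X ≠ 0)
    (h1 : 2 * X + 1 ≠ 0) (h2 : 2 * X - 1 ≠ 0) :
    boundarySum μ X Y a d δ (fun _ => 1) = coupling 0 μ a Y (d + δ) := by
  obtain ⟨i, hi, w0, w1, w2⟩ := weight_eq h0 h1 h2
  rw [boundarySum, w0, w1, w2]
  rcases μ with _ | _ | _ <;>
  · change coupling .zero .zero a X d * _ * coupling .zero _ X Y δ * 1 +
      coupling .zero .neg a X d * _ * coupling .neg _ X Y δ * 1 +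
      coupling .zero .pos a X d * _ * coupling .pos _ X Y δ * 1 =
        coupling .zero _ a Y (d + δ)
    simp only [coupling]
    first
    | linear_combination (Y ^ 2 + a ^ 2 - (d + δ) ^ 2 + (d + δ) - 1 / 2) * hi
    | linear_combination ((Y + a + (d + δ)) * (Y - a + (d + δ))) * hi
    | linear_combination ((-Y + a + (d + δ)) * (-Y - a + (d + δ))) * hi

/-- The base point d + a makes the action bidiagonal: a shift of X costs one linear factor of the
even polynomial, and the boundary coupling with ν = ±1 supplies exactly that factor. -/
theorem boundarySum_evenPoch (μ : SignType) {X : F} (Y a d δ : F) (l : ℕ) (h0 : 2 * X ≠ 0)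
    (h1 : 2 * X + 1 ≠ 0) (h2 : 2 * X - 1 ≠ 0) :
    boundarySum μ X Y a d δ (fun X => evenPoch (d + a) X (l + 1)) =
      coupling 0 μ a Y (d + δ + (l + 1)) * evenPoch (d + a) X (l + 1) -
      (l + 1) * (2 * d + l) * coupling 1 μ (d + a + l) Y δ * evenPoch (d + a) X l := by
  obtain ⟨i, hi, w0, w1, w2⟩ := weight_eq h0 h1 h2
  have e1 : evenPoch (d + a) (X + 1) (l + 1) * (d + a + X) =
      evenPoch (d + a) X l * ((d + a - X - 1) * (d + a + X + l) * (d + a + X + l + 1)) := by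
    have := poch_succ_left (d + a + X) (l + 1)
    rw [poch_succ, poch_succ] at this
    rw [evenPoch, evenPoch, poch_succ_left, ← add_assoc (d + a) X 1,
      show d + a - (X + 1) + 1 = d + a - X by ring]
    push_cast at this
    linear_combination -((d + a - (X + 1)) * poch (d + a - X) l) * this
  have e2 : evenPoch (d + a) (X - 1) (l + 1) * (d + a - X) =
      evenPoch (d + a) X l * ((d + a + X - 1) * (d + a - X + l) * (d + a - X + l + 1)) := by
    have := poch_succ_left (d + a - X) (l + 1)
    rw [poch_succ, poch_succ] at this
    rw [evenPoch, evenPoch, poch_succ_left (d + a + (X - 1)),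
      show d + a - (X - 1) = d + a - X + 1 by ring,
      show d + a + (X - 1) + 1 = d + a + X by ring]
    push_cast at this
    linear_combination -((d + a + (X - 1)) * poch (d + a + X) l) * this
  have e3 : evenPoch (d + a) X (l + 1) =
      evenPoch (d + a) X l * ((d + a - X + l) * (d + a + X + l)) := by
    rw [evenPoch, evenPoch, poch_succ, poch_succ]; ring
  have f1 : coupling 0 1 a X d * evenPoch (d + a) (X + 1) (l + 1) = evenPoch (d + a) X l *
      ((d + a - X - 1) * (d + a + X + l) * (d + a + X + l + 1) * (X - a + d)) := by
    change (X + a + d) * (X - a + d) * _ = _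
    linear_combination (X - a + d) * e1
  have f2 : coupling 0 (-1) a X d * evenPoch (d + a) (X - 1) (l + 1) = evenPoch (d + a) X l *
      ((d + a + X - 1) * (d + a - X + l) * (d + a - X + l + 1) * (-X - a + d)) := by
    change (-X + a + d) * (-X - a + d) * _ = _
    linear_combination (-X - a + d) * e2
  have key : boundarySum μ X Y a d δ (fun X => evenPoch (d + a) X (l + 1)) =
      coupling 0 0 a X d * weight 0 X * coupling 0 μ X Y δ * evenPoch (d + a) X (l + 1) +
      weight (-1) X * coupling (-1) μ X Y δ *
        (coupling 0 (-1) a X d * evenPoch (d + a) (X - 1) (l + 1)) +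
      weight 1 X * coupling 1 μ X Y δ *
        (coupling 0 1 a X d * evenPoch (d + a) (X + 1) (l + 1)) := by
    rw [boundarySum]; ring
  rw [key, f1, f2, e3, w0, w1, w2]
  generalize evenPoch (d + a) X l = ψ
  generalize (l : F) = l
  rcases μ with _ | _ | _
  · change coupling .zero .zero a X d * _ * coupling .zero .zero X Y δ * _ +
      _ * coupling .neg .zero X Y δ * _ + _ * coupling .pos .zero X Y δ * _ =
        coupling .zero .zero a Y (d + δ + (l + 1)) * _ -
        (l + 1) * (2 * d + l) * coupling .pos .zero (d + a + l) Y δ * _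
    simp only [coupling]
    linear_combination ((Y ^ 2 + a ^ 2 - (d + δ + (l + 1)) ^ 2 + (d + δ + (l + 1)) - 1 / 2) *
      (ψ * ((d + a - X + l) * (d + a + X + l))) -
      (l + 1) * (2 * d + l) * ((Y - (d + a + l) - δ) * (Y + (d + a + l) + δ)) * ψ) * hi
  · change coupling .zero .zero a X d * _ * coupling .zero .neg X Y δ * _ +
      _ * coupling .neg .neg X Y δ * _ + _ * coupling .pos .neg X Y δ * _ =
        coupling .zero .neg a Y (d + δ + (l + 1)) * _ -
        (l + 1) * (2 * d + l) * coupling .pos .neg (d + a + l) Y δ * _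
    simp only [coupling]
    linear_combination ((-Y + a + (d + δ + (l + 1))) * (-Y - a + (d + δ + (l + 1))) *
      (ψ * ((d + a - X + l) * (d + a + X + l))) -
      (l + 1) * (2 * d + l) * (((d + a + l) - Y + δ) * ((d + a + l) - Y + δ + 1)) * ψ) * hi
  · change coupling .zero .zero a X d * _ * coupling .zero .pos X Y δ * _ +
      _ * coupling .neg .pos X Y δ * _ + _ * coupling .pos .pos X Y δ * _ =
        coupling .zero .pos a Y (d + δ + (l + 1)) * _ -
        (l + 1) * (2 * d + l) * coupling .pos .pos (d + a + l) Y δ * _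
    simp only [coupling]
    linear_combination ((Y + a + (d + δ + (l + 1))) * (Y - a + (d + δ + (l + 1))) *
      (ψ * ((d + a - X + l) * (d + a + X + l))) -
      (l + 1) * (2 * d + l) * (((d + a + l) + Y + δ) * ((d + a + l) + Y + δ + 1)) * ψ) * hi

end Contiguous

/-! ### The contiguous relation of the Racah polynomials -/

section Contiguous

variable {F : Type*} [Field F]

theorem evenPoch_connection_pos (G Y a D : F) (m : ℕ) (hD : D + a = G) :
    evenPoch G (Y + 1) (m + 1) * coupling 0 1 a Y D +
      (m + 1) * (2 * D + m) * ((G + Y) * (G + Y + 1)) * evenPoch (G + 1) (Y + 1) m =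
    coupling 0 1 a Y (D + (m + 1)) * evenPoch G Y (m + 1) := by
  change _ * ((Y + a + D) * (Y - a + D)) + _ =
    (Y + a + (D + (m + 1))) * (Y - a + (D + (m + 1))) * _
  subst hD
  have e1 : (D + a + Y + 1) * poch (D + a + Y + 1 + 1) m =
      poch (D + a + Y + 1) m * (D + a + Y + 1 + m) := by
    rw [← poch_succ_left, poch_succ]
  simp only [evenPoch]
  rw [poch_succ_left (D + a - (Y + 1)), poch_succ (D + a + (Y + 1)), poch_succ (D + a - Y),
    poch_succ_left (D + a + Y), show D + a - (Y + 1) + 1 = D + a - Y by ring,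
    show D + a + 1 - (Y + 1) = D + a - Y by ring,
    show D + a + 1 + (Y + 1) = D + a + Y + 1 + 1 by ring,
    show D + a + (Y + 1) = D + a + Y + 1 by ring]
  linear_combination (m + 1) * (2 * D + m) * (D + a + Y) * poch (D + a - Y) m * e1

theorem coupling_zero_neg (a Y D : F) : coupling 0 (-1) a Y D = coupling 0 1 a (-Y) D := rfl

theorem boundarySum_sum {ι : Type*} (s : Finset ι) (μ : SignType) (X Y a d δ : F)
    (c : ι → F) (f : ι → F → F) :
    boundarySum μ X Y a d δ (fun X => ∑ l ∈ s, c l * f l X) =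
      ∑ l ∈ s, c l * boundarySum μ X Y a d δ (f l) := by
  simp only [boundarySum, Finset.mul_sum, ← Finset.sum_add_distrib]
  exact Finset.sum_congr rfl fun _ _ => by ring

variable [CharZero F]

/-- The counterpart in Y of the bidiagonal action in X: the subdiagonal term recombines with the
polynomial in the shifted Y to give the polynomial in the unshifted Y. The case μ = -1 is the case μ
= 1 at -Y. -/
theorem evenPoch_connection (μ : SignType) (G Y a D : F) (X δ : F) (m : ℕ) (hD : D + a = G)
    (hX : X + δ = G) :
    evenPoch G (Y + ((μ : ℤ) : F)) (m + 1) * coupling 0 μ a Y D +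
      (m + 1) * (2 * D + m) * coupling 1 μ X Y δ * evenPoch (G + 1) (Y + ((μ : ℤ) : F)) m =
    coupling 0 μ a Y (D + (m + 1)) * evenPoch G Y (m + 1) := by
  obtain rfl | rfl | rfl : μ = 0 ∨ μ = -1 ∨ μ = 1 := by cases μ <;> simp
  · have e : (G - Y) * (G + Y) * evenPoch (G + 1) Y m = evenPoch G Y (m + 1) := by
      rw [evenPoch, evenPoch, poch_succ_left, poch_succ_left,
        show G + 1 - Y = G - Y + 1 by ring, show G + 1 + Y = G + Y + 1 by ring]
      ring
    subst hD
    simp only [SignType.coe_zero, Int.cast_zero, add_zero]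
    change _ * (a ^ 2 + Y ^ 2 - D ^ 2 + D - 1 / 2) +
      _ * ((Y - X - δ) * (Y + X + δ)) * _ =
      (a ^ 2 + Y ^ 2 - (D + (m + 1)) ^ 2 + (D + (m + 1)) - 1 / 2) * _
    rw [show X = D + a - δ by linear_combination hX]
    linear_combination -(m + 1) * (2 * D + m) * e
  · have h := evenPoch_connection_pos G (-Y) a D m hD
    simp only [← evenPoch_neg _ (-Y + 1), evenPoch_neg _ Y, neg_add, neg_neg] at h
    simp only [coupling_zero_neg, SignType.coe_neg_one, Int.cast_neg, Int.cast_one, ← h]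
    change _ + _ * ((X - Y + δ) * (X - Y + δ + 1)) * _ = _
    rw [show X = G - δ by linear_combination hX]
    ring
  · have h := evenPoch_connection_pos G Y a D m hD
    simp only [SignType.coe_one, Int.cast_one, ← h]
    change _ + _ * ((X + Y + δ) * (X + Y + δ + 1)) * _ = _
    rw [show X = G - δ by linear_combination hX]
    ring

/-- The contiguous relations of the Racah polynomials that move the boundary factor
`B^{0,·}` from `X` to `Y`. -/
theorem boundarySum_racahKernel (N : ℕ) (μ : SignType) {X : F} (Y a d δ : F) (h0 : 2 * X ≠ 0)
    (h1 : 2 * X + 1 ≠ 0) (h2 : 2 * X - 1 ≠ 0) :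
    boundarySum μ X Y a d δ (fun X => racahKernel N X (Y + ((μ : ℤ) : F)) a d δ) =
      coupling 0 μ a Y (d + δ + N) * racahKernel N X Y a d δ := by
  set Y' := Y + ((μ : ℤ) : F) with hY'
  have e : ∀ X, racahKernel N X Y' a d δ = ∑ l ∈ Finset.range (N + 1),
      (racahCoeff N d δ l * evenPoch (d + a + δ + l) Y' (N - l)) * evenPoch (d + a) X l :=
    fun X => Finset.sum_congr rfl fun _ _ => by ring
  have e0 : boundarySum μ X Y a d δ (fun X => evenPoch (d + a) X 0) =
      coupling 0 μ a Y (d + δ) := by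
    simp only [evenPoch_zero]
    exact boundarySum_one μ Y a d δ h0 h1 h2
  have step : ∑ l ∈ Finset.range (N + 1),
      (racahCoeff N d δ l * evenPoch (d + a + δ + l) Y' (N - l)) *
        boundarySum μ X Y a d δ (fun X => evenPoch (d + a) X l) =
      ∑ l ∈ Finset.range (N + 1), (racahCoeff N d δ l * evenPoch (d + a + δ + l) Y' (N - l)) *
        (coupling 0 μ a Y (d + δ + l) * evenPoch (d + a) X l) -
      ∑ l ∈ Finset.range N,
        (racahCoeff N d δ (l + 1) * evenPoch (d + a + δ + (l + 1 : ℕ)) Y' (N - (l + 1))) *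
        ((l + 1) * (2 * d + l) * coupling 1 μ (d + a + l) Y δ * evenPoch (d + a) X l) := by
    rw [Finset.sum_range_succ', Finset.sum_range_succ', e0, add_sub_right_comm,
      ← Finset.sum_sub_distrib]
    congr 1
    · refine Finset.sum_congr rfl fun l _ => ?_
      rw [boundarySum_evenPoch μ Y a d δ l h0 h1 h2]
      push_cast
      ring
    · simp
  simp only [e]
  rw [boundarySum_sum, step, Finset.sum_range_succ, racahKernel, Finset.sum_range_succ, mul_add,
    Finset.mul_sum, add_sub_right_comm, ← Finset.sum_sub_distrib]
  congr 1
  · refine Finset.sum_congr rfl fun l hl => ?_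
    have hlt := Finset.mem_range.1 hl
    -- With N = l + m + 1 and D = d + δ + l the factor (l - N)(N + 2d + 2δ - 1 + l) is -(m + 1)(2D +
    -- m), the coefficient in `evenPoch_connection`.
    have hc := racahCoeff_succ N d δ hlt
    obtain ⟨m, rfl⟩ := Nat.exists_eq_add_of_lt hlt
    have hk := evenPoch_connection μ (d + a + δ + l) Y a (d + δ + l) (d + a + l) δ m
      (by ring) (by ring)
    rw [← hY'] at hk
    rw [show l + m + 1 - l = m + 1 by omega, show l + m + 1 - (l + 1) = m by omega]
    push_cast at hc ⊢
    rw [← add_assoc (d + a + δ) (l : F) 1,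
      show d + δ + ((l : F) + m + 1) = d + δ + l + (m + 1) by ring]
    linear_combination (racahCoeff (l + m + 1) d δ l * evenPoch (d + a) X l) * hk -
      (evenPoch (d + a + δ + l + 1) Y' m * coupling 1 μ (d + a + l) Y δ *
        evenPoch (d + a) X l) * hc
  · simp
    ring

/-- The parameters pair off: -x and x + γ + δ + 1 become d + a ∓ X, the lower parameters γ + 1 and β
+ δ + 1 become d + a + δ ∓ Y, and α + 1 becomes 2d. -/
theorem racahPoly_eq_racahKernel (N : ℕ) (S x y b₀ b c : F) :
    racahPoly N (2 * S + b - b₀ - 1) (c - b - 1) (S - y - 1) (S + b + y) (-S + x) =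
      racahKernel N (x + b / 2) (y + c / 2) (b₀ / 2) ((b - b₀) / 2 + S) ((c - b) / 2) := by
  refine Finset.sum_congr rfl fun l _ => ?_
  change poch _ _ * poch _ _ * poch _ _ * poch _ _ / _ * (poch _ _ * poch _ _ * poch _ _) = _
  simp only [racahCoeff, evenPoch]
  ring_nf

end Contiguous

/-! ### Half-integer shifts and the relations of spinor families -/

section Levels

/-- The invariant symplectic form `ε_{ij} = j - i` on two spinor indices. -/
def eps (i j : Fin 2) : ℤ := (j : ℤ) - (i : ℤ)

/-- Half-integer shifts `e_i : X_{i+1} ↦ X_{i+1} + 1/2` of the symmetric coordinates `X_i`. -/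
structure HalfShifts (k F : Type*) [Field k] [Field F] [Algebra k F] where
  X : ℕ → F
  δ : ℕ → F
  e : ℕ → F ≃ₐ[k] F
  e_X : ∀ i j, e i (X j) = X j + if j = i + 1 then 1 / 2 else 0
  e_δ : ∀ i j, e i (δ j) = δ j
  e_comm : ∀ i j f, e i (e j f) = e j (e i f)

variable {k F : Type*} [Field k] [Field F] [Algebra k F]

/-- The combination of raising and lowering spinors with spectral parameter `Z`. -/
def spinorFamily (Y δ : F) (u d : Fin 2 → Module.End k F) (Z : F) (a : Fin 2) :
    Module.End k F :=
  mulOp k ((Z + Y + δ) / (2 * Y)) * u a + mulOp k ((Y - Z - δ) / (2 * Y)) * d a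

theorem spinorFamily_apply (Y δ : F) (u d : Fin 2 → Module.End k F) (Z : F) (a : Fin 2) (f : F) :
    spinorFamily Y δ u d Z a f =
      (Z + Y + δ) / (2 * Y) * u a f + (Y - Z - δ) / (2 * Y) * d a f := rfl

/-- Raising and lowering spinors for the coordinate `X_{l+1}`. -/
structure IsSpinorLevel (H : HalfShifts k F) (l : ℕ) (u d : Fin 2 → Module.End k F) : Prop where
  u_mul : ∀ a g f, (∀ i, l < i → H.e i g = g) → u a (g * f) = H.e l g * u a f
  d_mul : ∀ a g f, (∀ i, l < i → H.e i g = g) → d a (g * f) = (H.e l).symm g * d a f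
  u_e : ∀ a i f, i < l → u a (H.e i f) = H.e i (u a f)
  d_e : ∀ a i f, i < l → d a (H.e i f) = H.e i (d a f)
  u_comm : ∀ a b f, u a (u b f) = u b (u a f)
  d_comm : ∀ a b f, d a (d b f) = d b (d a f)
  ud : ∀ a b f, u a (d b f) - u b (d a f) = eps a b * (2 * H.X (l + 1) + 1) * f
  du : ∀ a b f, d a (u b f) = u b (d a f) + eps a b * f

namespace HalfShifts

variable (H : HalfShifts k F)

theorem e_symm_X (i j : ℕ) : (H.e i).symm (H.X j) = H.X j - if j = i + 1 then 1 / 2 else 0 := by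
  rw [AlgEquiv.symm_apply_eq, map_sub, H.e_X]
  split_ifs <;> simp [map_ofNat]

theorem e_symm_δ (i j : ℕ) : (H.e i).symm (H.δ j) = H.δ j := by
  rw [AlgEquiv.symm_apply_eq, H.e_δ]

theorem e_symm_comm (i j : ℕ) (f : F) : H.e i ((H.e j).symm f) = (H.e j).symm (H.e i f) := by
  rw [AlgEquiv.eq_symm_apply, H.e_comm, AlgEquiv.apply_symm_apply]

theorem e_symm_symm_comm (i j : ℕ) (f : F) :
    (H.e i).symm ((H.e j).symm f) = (H.e j).symm ((H.e i).symm f) := by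
  rw [AlgEquiv.eq_symm_apply, H.e_symm_comm, AlgEquiv.apply_symm_apply]

variable [CharZero F]

/-- A shift raises the left side by 1 but fixes 0. -/
theorem two_mul_X_add_ne_zero (i : ℕ) (c : ℤ) : 2 * H.X (i + 1) + c ≠ 0 := by
  intro h
  have h2 := congrArg (H.e i) h
  simp only [map_add, map_mul, H.e_X, if_true, map_intCast, map_ofNat, map_zero] at h2
  have : (1 : F) = 0 := by linear_combination h2 - h
  exact one_ne_zero this

theorem X_ne_zero (i : ℕ) : H.X (i + 1) ≠ 0 := by
  have := H.two_mul_X_add_ne_zero i 0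
  simpa using this

theorem two_mul_X_add_one_ne_zero (i : ℕ) : 2 * H.X (i + 1) + 1 ≠ 0 := by
  simpa using H.two_mul_X_add_ne_zero i 1

theorem two_mul_X_sub_one_ne_zero (i : ℕ) : 2 * H.X (i + 1) - 1 ≠ 0 := by
  simpa [sub_eq_add_neg] using H.two_mul_X_add_ne_zero i (-1)

theorem weight_X (l : ℕ) :
    ∃ i : F, 2 * H.X (l + 1) * (2 * H.X (l + 1) + 1) * (2 * H.X (l + 1) - 1) * i = 1 ∧
      weight 0 (H.X (l + 1)) = 4 * H.X (l + 1) * i ∧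
      weight 1 (H.X (l + 1)) = (2 * H.X (l + 1) - 1) * i ∧
      weight (-1) (H.X (l + 1)) = (2 * H.X (l + 1) + 1) * i :=
  weight_eq (mul_ne_zero two_ne_zero (H.X_ne_zero l)) (H.two_mul_X_add_one_ne_zero l)
    (H.two_mul_X_sub_one_ne_zero l)

/-- The spinors of level `l`, expressed through a common top level `r` levels higher. -/
def spinors : ℕ → ℕ → (Fin 2 → Module.End k F) × (Fin 2 → Module.End k F)
  | 0, l =>
    (![(H.e l).toLinearMap * (H.e (l + 1)).toLinearMap,
        (H.e l).toLinearMap * (H.e (l + 1)).symm.toLinearMap],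
      ![mulOp k (H.X (l + 1 + 1) - H.X (l + 1) + 1 / 2) *
          ((H.e l).symm.toLinearMap * (H.e (l + 1)).toLinearMap),
        mulOp k (H.X (l + 1 + 1) + H.X (l + 1) - 1 / 2) *
          ((H.e l).symm.toLinearMap * (H.e (l + 1)).symm.toLinearMap)])
  | r + 1, l =>
    (fun a => spinorFamily (H.X (l + 1 + 1)) (H.δ (l + 1)) (spinors r (l + 1)).1
        (spinors r (l + 1)).2 (H.X (l + 1)) a * (H.e l).toLinearMap,
      fun a => spinorFamily (H.X (l + 1 + 1)) (H.δ (l + 1)) (spinors r (l + 1)).1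
        (spinors r (l + 1)).2 (-H.X (l + 1)) a * (H.e l).symm.toLinearMap)

end HalfShifts

namespace IsSpinorLevel

variable [CharZero F] {H : HalfShifts k F} {l : ℕ} {u d : Fin 2 → Module.End k F}

/-- The spinor family of level `l`. -/
local notation "𝓐" => spinorFamily (H.X (l + 1)) (H.δ l) u d

/-- Since W is invariant, moving the inner coefficients past the outer u or d only changes X_{l+1}
by ±1/2; the shifted denominators combine to the weights. -/
theorem family_mul_family (h : IsSpinorLevel H l u d) {W : F} (hW : ∀ i, l ≤ i → H.e i W = W)
    (Z : F) (a b : Fin 2) (f : F) :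
    𝓐 Z a (𝓐 W b f) =
      (Z + H.X (l + 1) + H.δ l) * (W + H.X (l + 1) + 1 / 2 + H.δ l) *
        weight 1 (H.X (l + 1)) * u a (u b f) +
      (Z + H.X (l + 1) + H.δ l) * (H.X (l + 1) + 1 / 2 - W - H.δ l) *
        weight 1 (H.X (l + 1)) * u a (d b f) +
      (H.X (l + 1) - Z - H.δ l) * (W + H.X (l + 1) - 1 / 2 + H.δ l) *
        weight (-1) (H.X (l + 1)) * d a (u b f) +
      (H.X (l + 1) - Z - H.δ l) * (H.X (l + 1) - 1 / 2 - W - H.δ l) *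
        weight (-1) (H.X (l + 1)) * d a (d b f) := by
  have hW' : (H.e l).symm W = W := by rw [AlgEquiv.symm_apply_eq, hW l le_rfl]
  have hX : ∀ i, l < i → H.e i (H.X (l + 1)) = H.X (l + 1) := fun i hi => by
    rw [H.e_X, if_neg (by omega), add_zero]
  have hg : ∀ i, l < i → H.e i ((W + H.X (l + 1) + H.δ l) / (2 * H.X (l + 1))) =
      (W + H.X (l + 1) + H.δ l) / (2 * H.X (l + 1)) := fun i hi => by
    simp [hX i hi, hW i hi.le, H.e_δ, map_ofNat]
  have hg' : ∀ i, l < i → H.e i ((H.X (l + 1) - W - H.δ l) / (2 * H.X (l + 1))) =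
      (H.X (l + 1) - W - H.δ l) / (2 * H.X (l + 1)) := fun i hi => by
    simp [hX i hi, hW i hi.le, H.e_δ, map_ofNat]
  simp only [spinorFamily_apply, map_add]
  rw [h.u_mul _ _ _ hg, h.u_mul _ _ _ hg', h.d_mul _ _ _ hg, h.d_mul _ _ _ hg']
  simp only [map_div₀, map_add, map_sub, map_mul, map_ofNat, H.e_X, H.e_symm_X, H.e_δ,
    H.e_symm_δ, hW l le_rfl, hW', if_true]
  rw [show 2 * (H.X (l + 1) + 1 / 2) = 2 * H.X (l + 1) + 1 by ring,
    show 2 * (H.X (l + 1) - 1 / 2) = 2 * H.X (l + 1) - 1 by ring]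
  rw [show weight 1 (H.X (l + 1)) = 1 / ((2 * H.X (l + 1) + 1) * (2 * H.X (l + 1))) from rfl,
    show weight (-1) (H.X (l + 1)) = 1 / ((-(2 * H.X (l + 1)) + 1) * -(2 * H.X (l + 1))) from rfl,
    show (-(2 * H.X (l + 1)) + 1) * -(2 * H.X (l + 1)) =
      (2 * H.X (l + 1) - 1) * (2 * H.X (l + 1)) by ring]
  simp only [div_eq_mul_inv, mul_inv]
  ring

/-- With X = X_{l+1}, the antisymmetric parts of ud and du are ε(2X + 1) and -ε(2X - 1). At W = Z +
1/2 their coefficients are in the ratio (2X - 1) : (2X + 1), so the parts cancel. At W = -Z - 1/2,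
in the next lemma, X drops out but a multiple of ε survives. -/
theorem family_symm (h : IsSpinorLevel H l u d) {Z : F} (hZ : ∀ i, l ≤ i → H.e i Z = Z)
    (a b : Fin 2) (f : F) : 𝓐 Z a (𝓐 (Z + 1 / 2) b f) = 𝓐 Z b (𝓐 (Z + 1 / 2) a f) := by
  have hW : ∀ i, l ≤ i → H.e i (Z + 1 / 2) = Z + 1 / 2 := fun i hi => by simp [hZ i hi, map_ofNat]
  obtain ⟨i, hi, -, w1, w2⟩ := H.weight_X l
  have e := h.ud a b f
  rw [h.family_mul_family hW, h.family_mul_family hW, h.u_comm b a, h.d_comm b a, h.du a b,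
    h.du b a, w1, w2, sub_eq_iff_eq_add.1 e, show eps b a = -eps a b by simp [eps]]
  push_cast
  ring

theorem family_antisymm (h : IsSpinorLevel H l u d) {Z : F} (hZ : ∀ i, l ≤ i → H.e i Z = Z)
    (a b : Fin 2) (f : F) :
    𝓐 Z a (𝓐 (-Z - 1 / 2) b f) - 𝓐 Z b (𝓐 (-Z - 1 / 2) a f) = eps a b * (2 * Z + 1) * f := by
  have hW : ∀ i, l ≤ i → H.e i (-Z - 1 / 2) = -Z - 1 / 2 := fun i hi => by simp [hZ i hi, map_ofNat]
  obtain ⟨i, hi, -, w1, w2⟩ := H.weight_X l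
  have e := h.ud a b f
  rw [h.family_mul_family hW, h.family_mul_family hW, h.u_comm b a, h.d_comm b a, h.du a b,
    h.du b a, w1, w2, sub_eq_iff_eq_add.1 e, show eps b a = -eps a b by simp [eps]]
  push_cast
  linear_combination (eps a b * (2 * Z + 1) * f) * hi

theorem family_exchange (h : IsSpinorLevel H l u d) {Z : F} (hZ : ∀ i, l ≤ i → H.e i Z = Z)
    (a b : Fin 2) (f : F) :
    𝓐 (-Z - 1 / 2) a (𝓐 Z b f) = 𝓐 (Z + 1 / 2) b (𝓐 (-Z - 1) a f) + eps a b * f := by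
  have hW : ∀ i, l ≤ i → H.e i (-Z - 1) = -Z - 1 := fun i hi => by simp [hZ i hi]
  obtain ⟨i, hi, -, w1, w2⟩ := H.weight_X l
  have e := h.ud a b f
  rw [h.family_mul_family hZ, h.family_mul_family hW, h.u_comm b a, h.d_comm b a, h.du a b,
    h.du b a, w1, w2, sub_eq_iff_eq_add.1 e, show eps b a = -eps a b by simp [eps]]
  push_cast
  linear_combination (eps a b * f) * hi

theorem family_mul (h : IsSpinorLevel H l u d) (Z : F) (a : Fin 2) {g : F} (f : F)
    (hg : ∀ i, l ≤ i → H.e i g = g) : 𝓐 Z a (g * f) = g * 𝓐 Z a f := by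
  have hg' : (H.e l).symm g = g := by rw [AlgEquiv.symm_apply_eq, hg l le_rfl]
  rw [spinorFamily_apply, h.u_mul _ _ _ fun i hi => hg i hi.le,
    h.d_mul _ _ _ fun i hi => hg i hi.le, hg l le_rfl, hg', spinorFamily_apply]
  ring

theorem family_e (h : IsSpinorLevel H l u d) (Z : F) (a : Fin 2) {i : ℕ} (f : F) (hi : i < l) :
    𝓐 (H.e i Z) a (H.e i f) = H.e i (𝓐 Z a f) := by
  rw [spinorFamily_apply, h.u_e _ _ _ hi, h.d_e _ _ _ hi, spinorFamily_apply]
  simp [H.e_X, H.e_δ, hi.ne', map_ofNat]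

theorem family_e_symm (h : IsSpinorLevel H l u d) (Z : F) (a : Fin 2) {i : ℕ} (f : F)
    (hi : i < l) : (H.e i).symm (𝓐 Z a f) = 𝓐 ((H.e i).symm Z) a ((H.e i).symm f) := by
  rw [AlgEquiv.symm_apply_eq, ← h.family_e _ _ _ hi, AlgEquiv.apply_symm_apply,
    AlgEquiv.apply_symm_apply]

end IsSpinorLevel

end Levels

/-! ### Spinors and vectors, and the descent from one level to the next -/

section Levels

variable {k F : Type*} [Field k] [Field F] [Algebra k F]

theorem eps_swap (i j : Fin 2) : eps j i = -eps i j := by simp [eps]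

@[simp] theorem eps_self (i : Fin 2) : eps i i = 0 := by simp [eps]

@[simp] theorem eps_zero_one : eps 0 1 = 1 := rfl

@[simp] theorem eps_one_zero : eps 1 0 = -1 := rfl

/-! ### Symmetric products of spinors -/

/-- The symmetric product of two spinors. -/
def symProd (v w : Fin 2 → Module.End k F) (i j : Fin 2) : Module.End k F :=
  v i * w j + v j * w i

theorem symProd_apply (v w : Fin 2 → Module.End k F) (i j : Fin 2) (f : F) :
    symProd v w i j f = v i (w j f) + v j (w i f) := rfl

/-- `v` transforms as a spinor under `S`. -/
def IsSpinor (S : Fin 2 → Fin 2 → Module.End k F) (v : Fin 2 → Module.End k F) : Prop :=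
  ∀ i j a f, S i j (v a f) = v a (S i j f) + eps j a • v i f + eps i a • v j f

/-- `T` transforms as a vector under `S`. -/
def IsVector (S T : Fin 2 → Fin 2 → Module.End k F) : Prop :=
  ∀ i j a b f, S i j (T a b f) = T a b (S i j f) + eps j a • T i b f + eps i a • T j b f +
    eps j b • T a i f + eps i b • T a j f

theorem IsSpinor.symProd {S : Fin 2 → Fin 2 → Module.End k F} {v w : Fin 2 → Module.End k F}
    (hv : IsSpinor S v) (hw : IsSpinor S w) : IsVector S (symProd v w) := by
  intro i j a b f
  simp only [symProd_apply, map_add, hv _ _ _ _, hw _ _ _ _, map_zsmul]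
  module

/-- Exchanging the inner pair of a fourfold product gives a p q b, where the outer pairs are
symmetric in their indices. These terms agree in both orders of the two symmetric products, so only
ε terms remain. -/
theorem isVector_symProd_self {a b p q : Fin 2 → Module.End k F}
    (hba : ∀ i j f, b i (a j f) = p j (q i f) + eps i j • f)
    (hap : ∀ i j f, a i (p j f) = a j (p i f)) (hqb : ∀ i j f, q i (b j f) = q j (b i f)) :
    IsVector (symProd a b) (symProd a b) := by
  have hT : ∀ i j m l f, a m (p i (q l (b j f))) = a i (p m (q j (b l f))) := fun i j m l f => by
    rw [hap, hqb]
  intro i j m l f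
  simp only [symProd_apply, map_add, hba, map_zsmul]
  rw [hT i j m l, hT i j l m, hT j i m l, hT j i l m, eps_swap m j, eps_swap m i, eps_swap l j,
    eps_swap l i]
  module

namespace IsSpinorLevel

variable {H : HalfShifts k F} {l : ℕ} {u d : Fin 2 → Module.End k F}

theorem isSpinor_u (h : IsSpinorLevel H l u d) : IsSpinor (symProd u d) u := by
  intro i j a f
  simp only [symProd_apply, map_add, h.du, ← zsmul_eq_mul, map_zsmul]
  rw [h.u_comm i a, h.u_comm j a]
  module

theorem isSpinor_d (h : IsSpinorLevel H l u d) : IsSpinor (symProd u d) d := by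
  intro i j a f
  simp only [symProd_apply, map_add, h.du, ← zsmul_eq_mul]
  rw [h.d_comm i a, h.d_comm j a, eps_swap j a, eps_swap i a]
  module

end IsSpinorLevel

/-- `H.X l` is invariant under the shifts of the higher coordinates. -/
theorem HalfShifts.e_X_of_le (H : HalfShifts k F) (l : ℕ) (i : ℕ) (hi : l ≤ i) :
    H.e i (H.X l) = H.X l := by
  rw [H.e_X, if_neg (by omega), add_zero]

variable [CharZero F]

namespace HalfShifts

variable (H : HalfShifts k F)

/-- The two spinor components are the two half-shifts of an auxiliary coordinate X_{l+2}; the linear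
factors in the lowering spinor produce the ε terms. -/
theorem isSpinorLevel_top (l : ℕ) :
    IsSpinorLevel H l (H.spinors 0 l).1 (H.spinors 0 l).2 := by
  have u0 : ∀ f, (H.spinors 0 l).1 0 f = H.e l (H.e (l + 1) f) := fun _ => rfl
  have u1 : ∀ f, (H.spinors 0 l).1 1 f = H.e l ((H.e (l + 1)).symm f) := fun _ => rfl
  have d0 : ∀ f, (H.spinors 0 l).2 0 f = (H.X (l + 1 + 1) - H.X (l + 1) + 1 / 2) *
      (H.e l).symm (H.e (l + 1) f) := fun _ => rfl
  have d1 : ∀ f, (H.spinors 0 l).2 1 f = (H.X (l + 1 + 1) + H.X (l + 1) - 1 / 2) *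
      (H.e l).symm ((H.e (l + 1)).symm f) := fun _ => rfl
  have hs : ∀ i g, H.e i g = g → (H.e i).symm g = g := fun i g h => by
    rw [AlgEquiv.symm_apply_eq, h]
  have c1 : ∀ f, H.e (l + 1) (H.e l f) = H.e l (H.e (l + 1) f) := fun f => H.e_comm _ _ _
  have c2 : ∀ f, (H.e (l + 1)).symm (H.e l f) = H.e l ((H.e (l + 1)).symm f) := fun f =>
    (H.e_symm_comm _ _ _).symm
  have c3 : ∀ f, H.e (l + 1) ((H.e l).symm f) = (H.e l).symm (H.e (l + 1) f) := fun f =>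
    H.e_symm_comm _ _ _
  have c4 : ∀ f, (H.e (l + 1)).symm ((H.e l).symm f) = (H.e l).symm ((H.e (l + 1)).symm f) :=
    fun f => H.e_symm_symm_comm _ _ _
  refine ⟨?_, ?_, ?_, ?_, ?_, ?_, ?_, ?_⟩
  · intro a g f hg
    fin_cases a <;> simp [u0, u1, hg (l + 1) (by omega), hs (l + 1) g (hg _ (by omega))]
  · intro a g f hg
    fin_cases a <;> simp [d0, d1, hg (l + 1) (by omega), hs (l + 1) g (hg _ (by omega))] <;> ring
  · intro a i f hi
    fin_cases a <;> simp [u0, u1, H.e_comm i, H.e_symm_comm i]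
  · intro a i f hi
    fin_cases a <;> simp [d0, d1, H.e_comm i, H.e_symm_comm i, H.e_X, hi.ne',
      (show ¬ l + 1 = i by omega), map_ofNat]
  · intro a b f
    fin_cases a <;> fin_cases b <;> simp [u0, u1, c1, c2]
  · intro a b f
    fin_cases a <;> fin_cases b <;> simp [d0, d1, c3, c4, H.e_X, H.e_symm_X, map_ofNat] <;> ring
  · intro a b f
    fin_cases a <;> fin_cases b <;>
      simp [d0, d1, u0, u1, c3, c4, H.e_X, H.e_symm_X, map_ofNat] <;> ring
  · intro a b f
    fin_cases a <;> fin_cases b <;>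
      simp [d0, d1, u0, u1, c1, c2, c3, c4, H.e_X, H.e_symm_X, map_ofNat] <;> ring

end HalfShifts

namespace IsSpinorLevel

variable {H : HalfShifts k F} {l : ℕ} {u d : Fin 2 → Module.End k F}

/-- Moving `H.e l` or its inverse past a family at ±X_{l+1} changes the spectral parameter by 1/2 in
absolute value. These are the offsets in the three family relations, which thus become the relations
of the lower level. -/
theorem step (h : IsSpinorLevel H (l + 1) u d) : IsSpinorLevel H l
    (fun a => spinorFamily (H.X (l + 1 + 1)) (H.δ (l + 1)) u d (H.X (l + 1)) a *
      (H.e l).toLinearMap)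
    (fun a => spinorFamily (H.X (l + 1 + 1)) (H.δ (l + 1)) u d (-H.X (l + 1)) a *
      (H.e l).symm.toLinearMap) := by
  have hX : ∀ i, l + 1 ≤ i → H.e i (H.X (l + 1)) = H.X (l + 1) := fun i hi => by
    rw [H.e_X, if_neg (by omega), add_zero]
  have hXn : ∀ i, l + 1 ≤ i → H.e i (-H.X (l + 1)) = -H.X (l + 1) := fun i hi => by
    rw [map_neg, hX i hi]
  have hXs : ∀ i, l + 1 ≤ i → H.e i (H.X (l + 1) - 1 / 2) = H.X (l + 1) - 1 / 2 := fun i hi => by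
    simp [hX i hi, map_ofNat]
  have s1 : ∀ Z b f, H.e l (spinorFamily (H.X (l + 1 + 1)) (H.δ (l + 1)) u d Z b f) =
      spinorFamily (H.X (l + 1 + 1)) (H.δ (l + 1)) u d (H.e l Z) b (H.e l f) := fun Z b f =>
    (h.family_e Z b f (Nat.lt_succ_self l)).symm
  have s2 : ∀ Z b f, (H.e l).symm (spinorFamily (H.X (l + 1 + 1)) (H.δ (l + 1)) u d Z b f) =
      spinorFamily (H.X (l + 1 + 1)) (H.δ (l + 1)) u d ((H.e l).symm Z) b ((H.e l).symm f) :=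
    fun Z b f => h.family_e_symm Z b f (Nat.lt_succ_self l)
  refine ⟨?_, ?_, ?_, ?_, ?_, ?_, ?_, ?_⟩
  · intro a g f hg
    simp only [Module.End.mul_apply, AlgEquiv.toLinearMap_apply, map_mul]
    exact h.family_mul _ _ _ fun i hi => by rw [H.e_comm, hg i hi]
  · intro a g f hg
    simp only [Module.End.mul_apply, AlgEquiv.toLinearMap_apply, map_mul]
    exact h.family_mul _ _ _ fun i hi => by rw [H.e_symm_comm, hg i hi]
  · intro a i f hi
    simp only [Module.End.mul_apply, AlgEquiv.toLinearMap_apply]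
    rw [H.e_comm l i, ← h.family_e _ _ _ (hi.trans (Nat.lt_succ_self l)), H.e_X,
      if_neg (by omega), add_zero]
  · intro a i f hi
    simp only [Module.End.mul_apply, AlgEquiv.toLinearMap_apply]
    rw [← H.e_symm_comm i l, ← h.family_e _ _ _ (hi.trans (Nat.lt_succ_self l)), map_neg, H.e_X,
      if_neg (by omega), add_zero]
  · intro a b f
    simp only [Module.End.mul_apply, AlgEquiv.toLinearMap_apply, s1, H.e_X, if_true]
    exact h.family_symm hX a b _
  · intro a b f
    simp only [Module.End.mul_apply, AlgEquiv.toLinearMap_apply, s2, H.e_symm_X, if_true, map_neg,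
      neg_sub]
    rw [show 1 / 2 - H.X (l + 1) = -H.X (l + 1) + 1 / 2 by ring]
    exact h.family_symm hXn a b _
  · intro a b f
    simp only [Module.End.mul_apply, AlgEquiv.toLinearMap_apply, s1, H.e_X, if_true, map_neg,
      AlgEquiv.apply_symm_apply]
    rw [show -(H.X (l + 1) + 1 / 2) = -H.X (l + 1) - 1 / 2 by ring]
    exact h.family_antisymm hX a b _
  · intro a b f
    simp only [Module.End.mul_apply, AlgEquiv.toLinearMap_apply, s1, s2, H.e_X, H.e_symm_X,
      if_true, map_neg, AlgEquiv.apply_symm_apply, AlgEquiv.symm_apply_apply]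
    -- The parameter is Z = X_{l+1} - 1/2, so that -Z - 1/2 = -X_{l+1} and Z + 1/2 = X_{l+1}.
    have := h.family_exchange hXs a b f
    rwa [show -(H.X (l + 1) - 1 / 2) - 1 / 2 = -H.X (l + 1) by ring, sub_add_cancel,
      show -(H.X (l + 1) - 1 / 2) - 1 = -(H.X (l + 1) + 1 / 2) by ring] at this

end IsSpinorLevel

theorem HalfShifts.isSpinorLevel (H : HalfShifts k F) (r l : ℕ) :
    IsSpinorLevel H l (H.spinors r l).1 (H.spinors r l).2 := by
  induction r generalizing l with
  | zero => exact H.isSpinorLevel_top l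
  | succ r ih => exact (ih (l + 1)).step

namespace IsSpinorLevel

variable {H : HalfShifts k F} {l : ℕ} {u d : Fin 2 → Module.End k F}

theorem isVector_family (h : IsSpinorLevel H l u d) :
    IsVector
      (symProd (spinorFamily (H.X (l + 1)) (H.δ l) u d (H.X l))
        (spinorFamily (H.X (l + 1)) (H.δ l) u d (-H.X l - 1 / 2)))
      (symProd (spinorFamily (H.X (l + 1)) (H.δ l) u d (H.X l))
        (spinorFamily (H.X (l + 1)) (H.δ l) u d (-H.X l - 1 / 2))) := by
  have hX := H.e_X_of_le l
  refine isVector_symProd_self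
    (p := spinorFamily (H.X (l + 1)) (H.δ l) u d (H.X l + 1 / 2))
    (q := spinorFamily (H.X (l + 1)) (H.δ l) u d (-H.X l - 1)) ?_ ?_ ?_
  · intro i j f
    rw [zsmul_eq_mul]
    exact h.family_exchange hX i j f
  · exact h.family_symm hX
  · have := h.family_symm (Z := -H.X l - 1) (fun i hi => by simp [hX i hi])
    rwa [show -H.X l - 1 + 1 / 2 = -H.X l - 1 / 2 by ring] at this

end IsSpinorLevel

end Levels

/-! ### Casimir operators and scalar products of vectors -/

section Casimir

variable {k F : Type*} [Field k] [Field F] [Algebra k F]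

theorem symProd_symm (v w : Fin 2 → Module.End k F) (i j : Fin 2) :
    symProd v w i j = symProd v w j i := add_comm _ _

/-- `J₀ = -S₀₁ / 2`. -/
def opJ0 (S : Fin 2 → Fin 2 → Module.End k F) : Module.End k F := (-1 / 2 : k) • S 0 1

/-- `J₊ = S₀₀ / 2`. -/
def opJp (S : Fin 2 → Fin 2 → Module.End k F) : Module.End k F := (1 / 2 : k) • S 0 0

/-- `J₋ = S₁₁ / 2`. -/
def opJm (S : Fin 2 → Fin 2 → Module.End k F) : Module.End k F := (1 / 2 : k) • S 1 1

/-- The Casimir operator `J₀² - J₀ - J₊ J₋`. -/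
def opCasimir (S : Fin 2 → Fin 2 → Module.End k F) : Module.End k F :=
  opJ0 S ^ 2 - opJ0 S - opJp S * opJm S

/-- The scalar product `2 J₀ J₀' - J₊ J₋' - J₋ J₊'`. -/
def opDot (S T : Fin 2 → Fin 2 → Module.End k F) : Module.End k F :=
  (2 : k) • (opJ0 S * opJ0 T) - opJp S * opJm T - opJm S * opJp T

theorem opCasimir_apply [CharZero k] (S : Fin 2 → Fin 2 → Module.End k F) (f : F) :
    opCasimir S f = (1 / 4 : k) • S 0 1 (S 0 1 f) + (1 / 2 : k) • S 0 1 f -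
      (1 / 4 : k) • S 0 0 (S 1 1 f) := by
  simp only [opCasimir, opJ0, opJp, opJm, pow_two, LinearMap.sub_apply, Module.End.mul_apply,
    LinearMap.smul_apply, map_smul]
  module

theorem opDot_apply [CharZero k] (S T : Fin 2 → Fin 2 → Module.End k F) (f : F) :
    opDot S T f = (1 / 2 : k) • S 0 1 (T 0 1 f) - (1 / 4 : k) • S 0 0 (T 1 1 f) -
      (1 / 4 : k) • S 1 1 (T 0 0 f) := by
  simp only [opDot, opJ0, opJp, opJm, LinearMap.sub_apply, Module.End.mul_apply,
    LinearMap.smul_apply, map_smul]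
  module

variable [CharZero k]

/-- S and T do not commute: bringing the cross terms into the order of the scalar product leaves a
multiple of J₀ of T, which corrects the sign of the linear term of the Casimir. -/
theorem opCasimir_sub {S T : Fin 2 → Fin 2 → Module.End k F} (h : IsVector S T)
    (hT : ∀ i j, T i j = T j i) :
    opCasimir (S - T) = opCasimir S + opCasimir T - opDot S T := by
  ext f
  have h1 := h 0 1 0 1 f
  have h2 := h 1 1 0 0 f
  simp only [eps_self, eps_zero_one, eps_one_zero, zero_smul, add_zero, one_smul, neg_smul,
    hT 1 0] at h1 h2
  simp only [LinearMap.sub_apply, LinearMap.add_apply, opCasimir_apply, opDot_apply, Pi.sub_apply,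
    map_sub, h1, h2]
  module

theorem opDot_self {S : Fin 2 → Fin 2 → Module.End k F} (h : IsVector S S)
    (hS : ∀ i j, S i j = S j i) (f : F) : opDot S S f = (2 : k) • opCasimir S f := by
  have h2 := h 1 1 0 0 f
  simp only [eps_one_zero, one_smul, neg_smul, hS 1 0] at h2
  simp only [opCasimir_apply, opDot_apply, h2]
  module

namespace IsSpinorLevel

variable {H : HalfShifts k F} {l : ℕ} {u d : Fin 2 → Module.End k F}

/-- The scalar product contracts indices with ε, and a contraction of two commuting u's vanishes;
the ε terms from reordering cancel as well. -/
theorem opDot_symProd_u (h : IsSpinorLevel H l u d) (f : F) :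
    opDot (symProd u d) (symProd u u) f = 0 := by
  have du : ∀ a b f, d a (u b f) = u b (d a f) + eps a b • f := fun a b f => by
    rw [h.du, zsmul_eq_mul]
  simp only [opDot_apply, symProd_apply, map_add, du, h.u_comm 1 0, eps_self, eps_zero_one,
    eps_one_zero, zero_smul, one_smul, neg_smul, add_zero, map_neg]
  module

theorem opDot_symProd_d (h : IsSpinorLevel H l u d) (f : F) :
    opDot (symProd u d) (symProd d d) f = 0 := by
  simp only [opDot_apply, symProd_apply, map_add, h.d_comm 1 0]
  module

variable [CharZero F]

/-- The spinor family of level `l`. -/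
local notation "𝓐" => spinorFamily (H.X (l + 1)) (H.δ l) u d

theorem opCasimir_family (h : IsSpinorLevel H l u d) (f : F) :
    opCasimir (symProd (𝓐 (H.X l)) (𝓐 (-H.X l - 1 / 2))) f = (H.X l ^ 2 - 1 / 4) * f := by
  have hX := H.e_X_of_le l
  have hX' : ∀ i, l ≤ i → H.e i (-H.X l - 1) = -H.X l - 1 := fun i hi => by simp [hX i hi]
  have hc : ∀ i, l ≤ i → H.e i (2 * H.X l + 1) = 2 * H.X l + 1 := fun i hi => by
    simp [hX i hi, map_ofNat]
  have hq := h.family_symm hX' 1 0 f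
  rw [show -H.X l - 1 + 1 / 2 = -H.X l - 1 / 2 by ring] at hq
  have e1 : ∀ f, 𝓐 (H.X l) 1 (𝓐 (-H.X l - 1 / 2) 0 f) =
      𝓐 (H.X l) 0 (𝓐 (-H.X l - 1 / 2) 1 f) - (2 * H.X l + 1) * f := fun f => by
    have := h.family_antisymm hX 0 1 f
    simp only [eps_zero_one, Int.cast_one, one_mul] at this
    rw [← this, sub_sub_cancel]
  -- Exchanging the inner pair on both sides makes the fourfold products equal by the symmetry `hq`
  -- of the last pair; only the ε term of the left side is left over.
  have e2 : 𝓐 (H.X l) 0 (𝓐 (-H.X l - 1 / 2) 0 (𝓐 (H.X l) 1 (𝓐 (-H.X l - 1 / 2) 1 f))) =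
      𝓐 (H.X l) 0 (𝓐 (-H.X l - 1 / 2) 1 (𝓐 (H.X l) 1 (𝓐 (-H.X l - 1 / 2) 0 f))) +
        𝓐 (H.X l) 0 (𝓐 (-H.X l - 1 / 2) 1 f) := by
    rw [h.family_exchange hX, h.family_exchange hX, hq]
    simp
  rw [opCasimir_apply]
  simp only [symProd_apply, map_add, map_sub, e1, e2,
    h.family_mul _ _ _ (g := 2 * H.X l + 1) hc]
  simp only [Algebra.smul_def, map_div₀, map_one, map_ofNat]
  ring

end IsSpinorLevel

end Casimir

/-! ### Expansion of vectors in those of the next level -/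

section Expansion

variable {k F : Type*} [Field k] [Field F] [Algebra k F]

/-- The three vectors that can be formed from the spinors of a level. -/
def levelVector (u d : Fin 2 → Module.End k F) : SignType → Fin 2 → Fin 2 → Module.End k F
  | .zero => symProd u d
  | .neg => symProd d d
  | .pos => symProd u u

/-- The first spectral parameter of the vector of type `ν`. -/
def spectralFst (ν : SignType) (X : F) : F :=
  match ν with
  | .zero => X
  | .neg => -X
  | .pos => X

/-- The second spectral parameter of the vector of type `ν`. -/
def spectralSnd (ν : SignType) (X : F) : F :=
  match ν with
  | .zero => -X - 1 / 2
  | .neg => -X + 1 / 2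
  | .pos => X + 1 / 2

/-- The shift of `X_{l+1}` by `ν`. -/
def HalfShifts.shift (H : HalfShifts k F) (l : ℕ) (ν : SignType) : F ≃ₐ[k] F :=
  (H.e l * H.e l) ^ (ν : ℤ)

namespace IsSpinorLevel

variable [CharZero F] {H : HalfShifts k F} {l : ℕ} {u d : Fin 2 → Module.End k F}

/-- The spinor family of level `l`. -/
local notation "𝓐" => spinorFamily (H.X (l + 1)) (H.δ l) u d

/-- This is the origin of the coefficients B/b: after ordering as ud and symmetrizing, the four
products of the family coefficients collapse to the couplings. -/
theorem symProd_family (h : IsSpinorLevel H l u d) (ν : SignType) {X : F}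
    (hX : ∀ i, l ≤ i → H.e i X = X) (i j : Fin 2) (f : F) :
    symProd (𝓐 (spectralFst ν X)) (𝓐 (spectralSnd ν X)) i j f =
      ∑ μ, coupling ν μ X (H.X (l + 1)) (H.δ l) * weight μ (H.X (l + 1)) *
        levelVector u d μ i j f := by
  have hW : ∀ i, l ≤ i → H.e i (spectralSnd ν X) = spectralSnd ν X := fun i hi => by
    cases ν <;> simp [spectralSnd, hX i hi, map_ofNat]
  obtain ⟨c, hc, w0, w1, w2⟩ := H.weight_X l
  rw [symProd_apply, h.family_mul_family hW, h.family_mul_family hW, sum_sign, h.u_comm j i,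
    h.d_comm j i, h.du i j, h.du j i, eps_swap i j, w0, w1, w2]
  change _ = _ * symProd u d i j f + _ * symProd d d i j f + _ * symProd u u i j f
  rw [symProd_apply, symProd_apply, symProd_apply, h.u_comm j i, h.d_comm j i]
  push_cast
  rcases ν with _ | _ | _
  · change _ = coupling .zero .zero _ _ _ * _ * _ + coupling .zero .neg _ _ _ * _ * _ +
      coupling .zero .pos _ _ _ * _ * _
    simp only [spectralFst, spectralSnd, coupling]
    ring
  · change _ = coupling .neg .zero _ _ _ * _ * _ + coupling .neg .neg _ _ _ * _ * _ +
      coupling .neg .pos _ _ _ * _ * _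
    simp only [spectralFst, spectralSnd, coupling]
    ring
  · change _ = coupling .pos .zero _ _ _ * _ * _ + coupling .pos .neg _ _ _ * _ * _ +
      coupling .pos .pos _ _ _ * _ * _
    simp only [spectralFst, spectralSnd, coupling]
    ring

/-- Both half-shifts are moved to the right, where they compose to the full shift by ν; passing the
second family, the first one changes its parameter to `spectralSnd`. -/
theorem levelVector_step (h : IsSpinorLevel H (l + 1) u d) (ν : SignType) (i j : Fin 2) (f : F) :
    levelVector
      (fun a => spinorFamily (H.X (l + 1 + 1)) (H.δ (l + 1)) u d (H.X (l + 1)) a *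
        (H.e l).toLinearMap)
      (fun a => spinorFamily (H.X (l + 1 + 1)) (H.δ (l + 1)) u d (-H.X (l + 1)) a *
        (H.e l).symm.toLinearMap) ν i j f =
      ∑ μ, coupling ν μ (H.X (l + 1)) (H.X (l + 1 + 1)) (H.δ (l + 1)) *
        weight μ (H.X (l + 1 + 1)) * levelVector u d μ i j (H.shift l ν f) := by
  rw [← h.symProd_family ν (H.e_X_of_le (l + 1))]
  have s1 : ∀ Z b f, H.e l (spinorFamily (H.X (l + 1 + 1)) (H.δ (l + 1)) u d Z b f) =
      spinorFamily (H.X (l + 1 + 1)) (H.δ (l + 1)) u d (H.e l Z) b (H.e l f) := fun Z b f =>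
    (h.family_e Z b f (Nat.lt_succ_self l)).symm
  have s2 : ∀ Z b f, (H.e l).symm (spinorFamily (H.X (l + 1 + 1)) (H.δ (l + 1)) u d Z b f) =
      spinorFamily (H.X (l + 1 + 1)) (H.δ (l + 1)) u d ((H.e l).symm Z) b ((H.e l).symm f) :=
    fun Z b f => h.family_e_symm Z b f (Nat.lt_succ_self l)
  rcases ν with _ | _ | _
  · have : H.shift l SignType.zero f = f := rfl
    simp only [levelVector, spectralFst, spectralSnd, symProd_apply, Module.End.mul_apply,
      AlgEquiv.toLinearMap_apply, s1, map_neg, H.e_X, if_true, AlgEquiv.apply_symm_apply, this]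
    rw [neg_add']
  · have : H.shift l SignType.neg f = (H.e l).symm ((H.e l).symm f) := by
      change ((H.e l * H.e l) ^ (-1 : ℤ)) f = _
      rw [zpow_neg_one, mul_inv_rev]
      rfl
    simp only [levelVector, spectralFst, spectralSnd, symProd_apply, Module.End.mul_apply,
      AlgEquiv.toLinearMap_apply, s2, map_neg, H.e_symm_X, if_true, this]
    rw [show -(H.X (l + 1) - 1 / 2) = -H.X (l + 1) + 1 / 2 by ring]
  · have : H.shift l SignType.pos f = H.e l (H.e l f) := by
      change ((H.e l * H.e l) ^ (1 : ℤ)) f = _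
      rw [zpow_one]
      rfl
    simp only [levelVector, spectralFst, spectralSnd, symProd_apply, Module.End.mul_apply,
      AlgEquiv.toLinearMap_apply, s1, H.e_X, if_true, this]

end IsSpinorLevel

end Expansion

/-! ### Sums over paths ν and their recursion in the first entry -/

section Paths

variable {k F : Type*} [Field k] [Field F] [Algebra k F]

theorem map_coupling {G : Type*} [FunLike G F F] [RingHomClass G F F] (φ : G) (s t : SignType)
    (X Y δ : F) : φ (coupling s t X Y δ) = coupling s t (φ X) (φ Y) (φ δ) := by
  cases s <;> cases t <;> simp [coupling, map_ofNat]

theorem map_weight {G : Type*} [FunLike G F F] [RingHomClass G F F] (φ : G) (s : SignType)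
    (X : F) : φ (weight s X) = weight s (φ X) := by
  cases s <;> simp [weight, map_ofNat]

/-- The factors of a summand that do not involve the initial point of the path. -/
def pathWeight : (j : ℕ) → (X δ : ℕ → F) → (Fin j → SignType) → F
  | 0, _, _, _ => 1
  | j + 1, X, δ, ν => weight (ν 0) (X 1) *
      coupling (ν 0) (extNu (Fin.tail ν) 1) (X 1) (X 2) (δ 1) *
        pathWeight j (sigma 1 X) (sigma 1 δ) (Fin.tail ν)

/-- The sum over all paths `ν` that start at `s`, with initial data `a` and `d`. -/
def pathSum (s : SignType) (a d : F) (X δ : ℕ → F) (E : ℕ → F ≃ₐ[k] F) (j : ℕ) (f : F) : F :=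
  ∑ ν : Fin j → SignType,
    coupling s (extNu ν 1) a (X 1) d * pathWeight j X δ ν * shiftBy E ν f

theorem extNu_zero (ν : Fin 0 → SignType) (i : ℕ) : extNu ν i = 0 := by
  rw [extNu, dif_neg (by omega)]

theorem extNu_one {j : ℕ} (ν : Fin (j + 1) → SignType) : extNu ν 1 = ν 0 := by
  rw [extNu, dif_pos (by omega)]
  rfl

theorem extNu_succ_succ {j : ℕ} (ν : Fin (j + 1) → SignType) (i : ℕ) :
    extNu ν (i + 2) = extNu (Fin.tail ν) (i + 1) := by
  by_cases h : i + 1 ≤ j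
  · rw [extNu, extNu, dif_pos (by omega), dif_pos (by omega)]
    rfl
  · rw [extNu, extNu, dif_neg (by omega), dif_neg (by omega)]

theorem shiftBy_succ (E : ℕ → F ≃ₐ[k] F) {j : ℕ} (ν : Fin (j + 1) → SignType) :
    shiftBy E ν = E 1 ^ ((ν 0 : SignType) : ℤ) * shiftBy (sigma 1 E) (Fin.tail ν) := by
  simp [shiftBy, List.ofFn_succ, sigma, Fin.tail]

theorem shiftBy_zero (E : ℕ → F ≃ₐ[k] F) (ν : Fin 0 → SignType) : shiftBy E ν = 1 := by
  simp [shiftBy]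

theorem commute_shiftBy {E : ℕ → F ≃ₐ[k] F} {g : F ≃ₐ[k] F} (h : ∀ i, Commute g (E (i + 1)))
    {j : ℕ} (ν : Fin j → SignType) : Commute g (shiftBy E ν) := by
  refine Commute.list_prod_right _ _ fun x hx => ?_
  obtain ⟨i, rfl⟩ := List.mem_ofFn.1 hx
  exact (h i).zpow_right _

theorem sum_sign_fun_succ {M : Type*} [AddCommMonoid M] {j : ℕ}
    (f : (Fin (j + 1) → SignType) → M) :
    ∑ ν, f ν = ∑ μ, ∑ ν : Fin j → SignType, f (Fin.cons μ ν) := by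
  rw [← (Fin.consEquiv fun _ => SignType).sum_comp, Fintype.sum_prod_type]
  rfl

theorem pathSum_zero (s : SignType) (a d : F) (X δ : ℕ → F) (E : ℕ → F ≃ₐ[k] F) (f : F) :
    pathSum s a d X δ E 0 f = coupling s 0 a (X 1) d * f := by
  simp [pathSum, extNu_zero, shiftBy_zero, pathWeight]

theorem pathSum_succ (s : SignType) (a d : F) (X δ : ℕ → F) {E : ℕ → F ≃ₐ[k] F}
    (hE : ∀ i j, Commute (E (i + 1)) (E (j + 1))) (j : ℕ) (f : F) :
    pathSum s a d X δ E (j + 1) f = ∑ μ, coupling s μ a (X 1) d * weight μ (X 1) *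
      pathSum μ (X 1) (δ 1) (sigma 1 X) (sigma 1 δ) (sigma 1 E) j
        ((E 1 ^ (μ : ℤ)) f) := by
  rw [pathSum, sum_sign_fun_succ]
  refine Finset.sum_congr rfl fun μ _ => ?_
  rw [pathSum, Finset.mul_sum]
  refine Finset.sum_congr rfl fun ν _ => ?_
  have hc : Commute (E 1 ^ ((μ : SignType) : ℤ)) (shiftBy (sigma 1 E) ν) :=
    commute_shiftBy (fun i => (hE 0 (i + 1)).zpow_left _) ν
  rw [extNu_one, shiftBy_succ, pathWeight, Fin.tail_cons, Fin.cons_zero, hc.eq,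
    AlgEquiv.mul_apply]
  simp only [sigma]
  ring

end Paths

/-! ### Total generators, their adjoint action and their scalar products -/

namespace HalfShifts

variable {k F : Type*} [Field k] [Field F] [Algebra k F] (H : HalfShifts k F)

/-- The total generators of the first `l + 1` sites, in a realization with `N + 1` sites. -/
def total (N l : ℕ) : Fin 2 → Fin 2 → Module.End k F :=
  symProd
    (spinorFamily (H.X (l + 1)) (H.δ l) (H.spinors (N - l) l).1 (H.spinors (N - l) l).2 (H.X l))
    (spinorFamily (H.X (l + 1)) (H.δ l) (H.spinors (N - l) l).1 (H.spinors (N - l) l).2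
      (-H.X l - 1 / 2))

variable {N : ℕ}

theorem spinors_of_lt {l : ℕ} (hl : l < N) : H.spinors (N - l) l =
    (fun a => spinorFamily (H.X (l + 1 + 1)) (H.δ (l + 1)) (H.spinors (N - (l + 1)) (l + 1)).1
        (H.spinors (N - (l + 1)) (l + 1)).2 (H.X (l + 1)) a * (H.e l).toLinearMap,
      fun a => spinorFamily (H.X (l + 1 + 1)) (H.δ (l + 1)) (H.spinors (N - (l + 1)) (l + 1)).1
        (H.spinors (N - (l + 1)) (l + 1)).2 (-H.X (l + 1)) a * (H.e l).symm.toLinearMap) := by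
  rw [show N - l = N - (l + 1) + 1 by omega]
  rfl

theorem total_symm (l : ℕ) (i j : Fin 2) : H.total N l i j = H.total N l j i :=
  symProd_symm _ _ _ _

variable [CharZero F]

theorem total_expand (l : ℕ) (i j : Fin 2) (f : F) : H.total N l i j f =
    ∑ μ, coupling 0 μ (H.X l) (H.X (l + 1)) (H.δ l) * weight μ (H.X (l + 1)) *
      levelVector (H.spinors (N - l) l).1 (H.spinors (N - l) l).2 μ i j f :=
  (H.isSpinorLevel (N - l) l).symProd_family 0 (H.e_X_of_le l) i j f

theorem levelVector_expand {l : ℕ} (hl : l < N) (ν : SignType) (i j : Fin 2) (f : F) :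
    levelVector (H.spinors (N - l) l).1 (H.spinors (N - l) l).2 ν i j f =
      ∑ μ, coupling ν μ (H.X (l + 1)) (H.X (l + 1 + 1)) (H.δ (l + 1)) *
        weight μ (H.X (l + 1 + 1)) *
        levelVector (H.spinors (N - (l + 1)) (l + 1)).1 (H.spinors (N - (l + 1)) (l + 1)).2 μ i j
          (H.shift l ν f) := by
  rw [H.spinors_of_lt hl]
  exact (H.isSpinorLevel (N - (l + 1)) (l + 1)).levelVector_step ν i j f

/-- The two sides have the same expansion at level l + 1, the path entry ν = 0 carrying no shift. -/
theorem total_succ {l : ℕ} (hl : l < N) :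
    H.total N (l + 1) = symProd (H.spinors (N - l) l).1 (H.spinors (N - l) l).2 := by
  funext i j
  ext f
  rw [total_expand]
  exact (H.levelVector_expand hl 0 i j f).symm

theorem total_mul (l : ℕ) (i j : Fin 2) {g : F} (f : F) (hg : ∀ i, l ≤ i → H.e i g = g) :
    H.total N l i j (g * f) = g * H.total N l i j f := by
  have h := H.isSpinorLevel (N - l) l
  simp only [total, symProd_apply, h.family_mul _ _ _ hg, mul_add]

/-- The coefficients of T_m involve X_m and higher coordinates only, so shifts of X_1, …, X_{m-1}
pass through. -/
theorem total_e {m i : ℕ} (hi : i + 1 < m) (a b : Fin 2) (f : F) :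
    H.total N m a b (H.e i f) = H.e i (H.total N m a b f) := by
  have h := H.isSpinorLevel (N - m) m
  have hX : H.e i (H.X m) = H.X m := by rw [H.e_X, if_neg (by omega), add_zero]
  have hX' : H.e i (-H.X m - 1 / 2) = -H.X m - 1 / 2 := by simp [hX, map_ofNat]
  have e1 : ∀ c f, spinorFamily (H.X (m + 1)) (H.δ m) (H.spinors (N - m) m).1
      (H.spinors (N - m) m).2 (H.X m) c (H.e i f) = H.e i (spinorFamily (H.X (m + 1)) (H.δ m)
        (H.spinors (N - m) m).1 (H.spinors (N - m) m).2 (H.X m) c f) := fun c f => by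
    rw [← h.family_e _ _ _ (by omega), hX]
  have e2 : ∀ c f, spinorFamily (H.X (m + 1)) (H.δ m) (H.spinors (N - m) m).1
      (H.spinors (N - m) m).2 (-H.X m - 1 / 2) c (H.e i f) =
        H.e i (spinorFamily (H.X (m + 1)) (H.δ m) (H.spinors (N - m) m).1
          (H.spinors (N - m) m).2 (-H.X m - 1 / 2) c f) := fun c f => by
    rw [← h.family_e _ _ _ (by omega), hX']
  simp only [total, symProd_apply, e1, e2, map_add]

theorem total_e_symm {m i : ℕ} (hi : i + 1 < m) (a b : Fin 2) (f : F) :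
    H.total N m a b ((H.e i).symm f) = (H.e i).symm (H.total N m a b f) := by
  rw [AlgEquiv.eq_symm_apply, ← H.total_e hi, AlgEquiv.apply_symm_apply]

theorem isSpinor_family {l m : ℕ} (hl : l < m) {Z : F} (hZ : ∀ i, m ≤ i → H.e i Z = Z)
    {u d : Fin 2 → Module.End k F} (hu : IsSpinor (H.total N m) u)
    (hd : IsSpinor (H.total N m) d) :
    IsSpinor (H.total N m) (spinorFamily (H.X (l + 1)) (H.δ l) u d Z) := by
  intro i j a f
  have hX : ∀ i, m ≤ i → H.e i (H.X (l + 1)) = H.X (l + 1) := fun i hi => by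
    rw [H.e_X, if_neg (by omega), add_zero]
  simp only [spinorFamily_apply, map_add]
  rw [H.total_mul m i j _ fun i hi => by simp [hX i hi, hZ i hi, H.e_δ, map_ofNat],
    H.total_mul m i j _ fun i hi => by simp [hX i hi, hZ i hi, H.e_δ, map_ofNat], hu, hd]
  simp only [zsmul_eq_mul]
  ring

/-- Descent from level m - 1, where T_m is the symmetric product of the spinors. Lower spinors arise
by multiplying with functions and shifts that commute with T_m. -/
theorem isSpinor_total {m l : ℕ} (hm : m ≤ N) (hl : l < m) :
    IsSpinor (H.total N m) (H.spinors (N - l) l).1 ∧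
      IsSpinor (H.total N m) (H.spinors (N - l) l).2 := by
  obtain ⟨t, rfl⟩ := Nat.exists_eq_add_of_lt hl
  clear hl
  induction t generalizing l with
  | zero =>
    rw [add_zero, H.total_succ (by omega)]
    exact ⟨(H.isSpinorLevel _ _).isSpinor_u, (H.isSpinorLevel _ _).isSpinor_d⟩
  | succ t ih =>
    rw [show l + (t + 1) + 1 = l + 1 + t + 1 by omega] at hm ⊢
    obtain ⟨hu, hd⟩ := ih hm
    have hX : ∀ i, l + 1 + t + 1 ≤ i → H.e i (H.X (l + 1)) = H.X (l + 1) := fun i hi => by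
      rw [H.e_X, if_neg (by omega), add_zero]
    rw [H.spinors_of_lt (l := l) (by omega)]
    constructor
    · have := H.isSpinor_family (l := l + 1) (by omega) hX hu hd
      intro i j a f
      simp only [Module.End.mul_apply, AlgEquiv.toLinearMap_apply]
      rw [this, H.total_e (by omega)]
    · have := H.isSpinor_family (l := l + 1) (by omega) (Z := -H.X (l + 1))
        (fun i hi => by rw [map_neg, hX i hi]) hu hd
      intro i j a f
      simp only [Module.End.mul_apply, AlgEquiv.toLinearMap_apply]
      rw [this, H.total_e_symm (by omega)]

theorem isVector_total {m l : ℕ} (hm : m ≤ N) (hl : l ≤ m) :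
    IsVector (H.total N m) (H.total N l) := by
  rcases hl.eq_or_lt with rfl | hl
  · exact (H.isSpinorLevel _ _).isVector_family
  · obtain ⟨hu, hd⟩ := H.isSpinor_total hm hl
    have hX : ∀ i, m ≤ i → H.e i (H.X l) = H.X l := fun i hi => H.e_X_of_le l i (by omega)
    exact (H.isSpinor_family hl hX hu hd).symProd
      (H.isSpinor_family hl (fun i hi => by simp [hX i hi, map_ofNat]) hu hd)

variable [CharZero k]

theorem opCasimir_total (l : ℕ) (f : F) :
    opCasimir (H.total N l) f = (H.X l ^ 2 - 1 / 4) * f :=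
  (H.isSpinorLevel _ _).opCasimir_family f

theorem opDot_total_sum {m : ℕ} {ι : Type*} [Fintype ι] (T : Fin 2 → Fin 2 → Module.End k F)
    (V : ι → Fin 2 → Fin 2 → Module.End k F) (c : ι → F) (f g : F)
    (hc : ∀ μ i, m ≤ i → H.e i (c μ) = c μ)
    (hT : ∀ i j, T i j f = ∑ μ, c μ * V μ i j g) :
    opDot (H.total N m) T f = ∑ μ, c μ * opDot (H.total N m) (V μ) g := by
  simp only [opDot_apply, hT, map_sum, H.total_mul m _ _ _ (hc _), Finset.smul_sum,
    ← Finset.sum_sub_distrib]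
  refine Finset.sum_congr rfl fun μ _ => ?_
  simp only [Algebra.smul_def]
  ring

theorem opDot_total_levelVector {l : ℕ} (hl : l < N) (ν : SignType) (f : F) :
    opDot (H.total N (l + 1)) (levelVector (H.spinors (N - l) l).1 (H.spinors (N - l) l).2 ν) f =
      if ν = 0 then 2 * (H.X (l + 1) ^ 2 - 1 / 4) * f else 0 := by
  have h := H.isSpinorLevel (N - l) l
  obtain rfl | rfl | rfl : ν = 0 ∨ ν = -1 ∨ ν = 1 := by cases ν <;> simp
  · change opDot _ (symProd _ _) f = _
    rw [← H.total_succ hl, opDot_self (H.isVector_total (by omega) le_rfl) (H.total_symm _),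
      opCasimir_total, if_pos rfl, Algebra.smul_def, map_ofNat, mul_assoc]
  · rw [H.total_succ hl, if_neg (by decide)]
    exact h.opDot_symProd_d f
  · rw [H.total_succ hl, if_neg (by decide)]
    exact h.opDot_symProd_u f

theorem sum_opDot_levelVector (l j : ℕ) (hl : l + j < N) (s : SignType) (a d : F) (X δ : ℕ → F)
    (E : ℕ → F ≃ₐ[k] F) (hX : ∀ i, X i = H.X (l + i)) (hδ : ∀ i, δ i = H.δ (l + i))
    (hE : ∀ i, E (i + 1) = H.e (l + i) * H.e (l + i)) (f : F) :
    ∑ μ, coupling s μ a (H.X (l + 1)) d * weight μ (H.X (l + 1)) *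
      opDot (H.total N (l + j + 1))
        (levelVector (H.spinors (N - l) l).1 (H.spinors (N - l) l).2 μ) f =
      pathSum s a d X δ E j f := by
  have hcomm : ∀ i j, Commute (H.e i) (H.e j) := fun i j => AlgEquiv.ext (H.e_comm i j)
  induction j generalizing l s a d X δ E f with
  | zero =>
    obtain ⟨c, hc, w0, -, -⟩ := H.weight_X l
    simp only [add_zero] at hl ⊢
    simp only [H.opDot_total_levelVector hl]
    -- The path ends here: only μ = 0 survives, and its weight 2/(4X² - 1) cancels the factor 2(X² -
    -- 1/4) of the scalar product. This enforces ν_{j+1} = 0.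
    rw [Fintype.sum_eq_single 0 (fun μ hμ => by simp [hμ]), if_pos rfl, w0, pathSum_zero, hX]
    linear_combination coupling s 0 a (H.X (l + 1)) d * f * hc
  | succ j ih =>
    rw [pathSum_succ _ _ _ _ _ (fun i j => by
      rw [hE, hE]
      exact ((hcomm _ _).mul_right (hcomm _ _)).mul_left ((hcomm _ _).mul_right (hcomm _ _)))]
    refine Finset.sum_congr rfl fun μ _ => ?_
    rw [hX 1, hδ 1]
    congr 1
    rw [← ih (l + 1) (by omega) _ _ _ (sigma 1 X) (sigma 1 δ) (sigma 1 E)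
      (fun i => by rw [sigma, hX]; congr 1; omega) (fun i => by rw [sigma, hδ]; congr 1; omega)
      (fun i => by rw [sigma, hE]; congr 2 <;> omega)]
    rw [show l + 1 + j + 1 = l + (j + 1) + 1 by omega]
    have hE1 : E 1 ^ (μ : ℤ) = H.shift l μ := by rw [shift, hE 0, add_zero]
    rw [hE1]
    refine H.opDot_total_sum _ _ _ _ _ (fun μ' i hi => ?_)
      (fun i j => H.levelVector_expand (by omega) μ i j f)
    have h1 : H.e i (H.X (l + 1)) = H.X (l + 1) := H.e_X_of_le _ _ (by omega)
    have h2 : H.e i (H.X (l + 1 + 1)) = H.X (l + 1 + 1) := H.e_X_of_le _ _ (by omega)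
    rw [map_mul, map_coupling, map_weight, h1, h2, H.e_δ]

theorem opDot_total (l j : ℕ) (hl : l + j < N) (X δ : ℕ → F)
    (E : ℕ → F ≃ₐ[k] F) (hX : ∀ i, X i = H.X (l + i)) (hδ : ∀ i, δ i = H.δ (l + i))
    (hE : ∀ i, E (i + 1) = H.e (l + i) * H.e (l + i)) (f : F) :
    opDot (H.total N (l + j + 1)) (H.total N l) f = pathSum 0 (X 0) (δ 0) X δ E j f := by
  rw [← H.sum_opDot_levelVector l j hl 0 (X 0) (δ 0) X δ E hX hδ hE, hX 0, hδ 0]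
  refine H.opDot_total_sum _ _ _ _ _ (fun μ i hi => ?_) (fun i j => H.total_expand l i j f)
  have h1 : H.e i (H.X l) = H.X l := H.e_X_of_le _ _ (by omega)
  have h2 : H.e i (H.X (l + 1)) = H.X (l + 1) := H.e_X_of_le _ _ (by omega)
  rw [map_mul, map_coupling, map_weight, add_zero, h1, h2, H.e_δ]

end HalfShifts

/-! ### Path sums applied to products of Racah polynomials -/

section Eigenfunctions

variable {k F : Type*} [Field k] [Field F] [Algebra k F]

theorem map_poch {G : Type*} [FunLike G F F] [RingHomClass G F F] (φ : G) (a : F) (m : ℕ) :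
    φ (poch a m) = poch (φ a) m := by
  induction m with
  | zero => simp
  | succ m ih => simp [poch_succ, ih]

theorem map_racahKernel {G : Type*} [FunLike G F F] [RingHomClass G F F] (φ : G) (N : ℕ)
    (X Y a d δ : F) :
    φ (racahKernel N X Y a d δ) = racahKernel N (φ X) (φ Y) (φ a) (φ d) (φ δ) := by
  simp [racahKernel, racahCoeff, evenPoch, map_poch, map_ofNat]

theorem shiftBy_eq_self {E : ℕ → F ≃ₐ[k] F} {x : F} {j : ℕ} (h : ∀ i < j, E (i + 1) x = x)
    (ν : Fin j → SignType) : shiftBy E ν x = x := by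
  have hm : ∀ g : F ≃ₐ[k] F, g ∈ MulAction.stabilizer (F ≃ₐ[k] F) x ↔ g x = x := fun g => Iff.rfl
  rw [← hm]
  refine Subgroup.list_prod_mem _ fun g hg => ?_
  obtain ⟨i, rfl⟩ := List.mem_ofFn.1 hg
  exact Subgroup.zpow_mem _ ((hm _).2 (h i i.2)) _

theorem sign_zpow_apply {e : F ≃ₐ[k] F} {x : F} (h : e x = x + 1) (μ : SignType) :
    (e ^ (μ : ℤ)) x = x + ((μ : ℤ) : F) := by
  obtain rfl | rfl | rfl : μ = 0 ∨ μ = -1 ∨ μ = 1 := by cases μ <;> simp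
  · simp
  · have : e (x + -1) = x := by rw [map_add, h, map_neg, map_one, add_neg_cancel_right]
    simp only [SignType.coe_neg_one, zpow_neg_one, Int.cast_neg, Int.cast_one]
    exact (AlgEquiv.symm_apply_eq e).2 this.symm
  · simpa using h

theorem sign_zpow_apply_of_fixed {e : F ≃ₐ[k] F} {x : F} (h : e x = x) (μ : SignType) :
    (e ^ (μ : ℤ)) x = x :=
  Subgroup.zpow_mem (MulAction.stabilizer (F ≃ₐ[k] F) x) h (μ : ℤ)

/-- `E_{i+1}` shifts `X_{i+1}` by `1` and fixes the other coordinates and the parameters. -/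
structure IsShiftFamily (X δ : ℕ → F) (E : ℕ → F ≃ₐ[k] F) : Prop where
  X : ∀ i j, E (i + 1) (X (j + 1)) = X (j + 1) + if i = j then 1 else 0
  δ : ∀ i j, E (i + 1) (δ (j + 1)) = δ (j + 1)
  comm : ∀ i j, Commute (E (i + 1)) (E (j + 1))

namespace IsShiftFamily

variable {X δ : ℕ → F} {E : ℕ → F ≃ₐ[k] F}

theorem sigma_one (h : IsShiftFamily X δ E) :
    IsShiftFamily (sigma 1 X) (sigma 1 δ) (sigma 1 E) :=
  ⟨fun i j => by simpa [sigma] using h.X (i + 1) (j + 1), fun i j => h.δ (i + 1) (j + 1),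
    fun i j => h.comm (i + 1) (j + 1)⟩

theorem shiftBy_X_one (h : IsShiftFamily X δ E) {j : ℕ} (ν : Fin j → SignType) :
    shiftBy E ν (X 1) = X 1 + ((extNu ν 1 : ℤ) : F) := by
  cases j with
  | zero => simp [shiftBy_zero, extNu_zero]
  | succ j =>
    rw [shiftBy_succ, AlgEquiv.mul_apply, extNu_one, shiftBy_eq_self fun i _ => ?_,
      sign_zpow_apply (by simpa using h.X 0 0)]
    simpa [sigma] using h.X (i + 1) 0

variable [CharZero F]

theorem two_mul_X_add_ne_zero (h : IsShiftFamily X δ E) (i : ℕ) (c : ℤ) :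
    2 * X (i + 1) + c ≠ 0 := by
  intro h0
  have h2 := congrArg (E (i + 1)) h0
  simp only [map_add, map_mul, h.X, if_true, map_intCast, map_ofNat, map_zero] at h2
  have : (2 : F) = 0 := by linear_combination h2 - h0
  exact two_ne_zero this

theorem pathSum_racahKernel_mul (h : IsShiftFamily X δ E) {a d g : F}
    (ha : ∀ i, E (i + 1) a = a) (hd : ∀ i, E (i + 1) d = d) (hg : E 1 g = g) (n j : ℕ) :
    pathSum 0 a d X δ E (j + 1) (racahKernel n (X 1) (X 2) a d (δ 1) * g) =
      racahKernel n (X 1) (X 2) a d (δ 1) *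
        pathSum 0 a (d + δ 1 + n) (sigma 1 X) (sigma 1 δ) (sigma 1 E) j g := by
  -- The tail of the path is fixed first. It shifts X_2 by its first entry, and the sum over ν_1
  -- becomes a `boundarySum` with that entry as μ.
  rw [pathSum, sum_sign_fun_succ, Finset.sum_comm, pathSum, Finset.mul_sum]
  refine Finset.sum_congr rfl fun ν _ => ?_
  have hS : ∀ μ, shiftBy E (Fin.cons μ ν : Fin (j + 1) → SignType)
      (racahKernel n (X 1) (X 2) a d (δ 1) * g) =
        racahKernel n (X 1 + ((μ : ℤ) : F)) (X 2 + ((extNu ν 1 : ℤ) : F)) a d (δ 1) *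
          shiftBy (sigma 1 E) ν g := fun μ => by
    have hc : Commute (E 1 ^ ((μ : SignType) : ℤ)) (shiftBy (sigma 1 E) ν) :=
      commute_shiftBy (fun i => (h.comm 0 (i + 1)).zpow_left _) ν
    have h2 : shiftBy (sigma 1 E) ν (X 2) = X 2 + ((extNu ν 1 : ℤ) : F) :=
      h.sigma_one.shiftBy_X_one ν
    have h1 : shiftBy (sigma 1 E) ν (X 1) = X 1 :=
      shiftBy_eq_self (fun i _ => by simpa [sigma] using h.X (i + 1) 0) ν
    rw [shiftBy_succ, Fin.tail_cons, Fin.cons_zero, hc.eq, AlgEquiv.mul_apply, map_mul,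
      map_racahKernel, sign_zpow_apply (by simpa using h.X 0 0),
      sign_zpow_apply_of_fixed (by simpa using h.X 0 1), sign_zpow_apply_of_fixed (ha 0),
      sign_zpow_apply_of_fixed (hd 0), sign_zpow_apply_of_fixed (h.δ 0 0),
      sign_zpow_apply_of_fixed hg, map_mul, map_racahKernel, map_add, map_intCast, h1, h2,
      shiftBy_eq_self (fun i _ => ha (i + 1)), shiftBy_eq_self (fun i _ => hd (i + 1)),
      shiftBy_eq_self (fun i _ => h.δ (i + 1) 0)]
  have hb := boundarySum_racahKernel n (extNu ν 1) (X := X 1) (X 2) a d (δ 1)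
    (by simpa using h.two_mul_X_add_ne_zero 0 0) (by simpa using h.two_mul_X_add_ne_zero 0 1)
    (by simpa [sub_eq_add_neg] using h.two_mul_X_add_ne_zero 0 (-1))
  simp only [hS, extNu_one, Fin.cons_zero, pathWeight, Fin.tail_cons]
  rw [sum_sign]
  rw [boundarySum] at hb
  simp only [SignType.coe_zero, SignType.coe_neg_one, SignType.coe_one, Int.cast_zero, add_zero,
    Int.cast_neg, Int.cast_one, ← sub_eq_add_neg, sigma]
  linear_combination (pathWeight j (sigma 1 X) (sigma 1 δ) ν * shiftBy (sigma 1 E) ν g) * hb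

theorem pathSum_prod_racahKernel (h : IsShiftFamily X δ E) {a d g : F}
    (ha : ∀ i, E (i + 1) a = a) (hd : ∀ i, E (i + 1) d = d) (n : ℕ → ℕ) (j : ℕ)
    (hg : ∀ i < j, E (i + 1) g = g) :
    pathSum 0 a d X δ E j ((∏ i ∈ Finset.range j, racahKernel (n i) (X (i + 1)) (X (i + 2)) a
        (d + ∑ t ∈ Finset.range i, (δ (t + 1) + n t)) (δ (i + 1))) * g) =
      coupling 0 0 a (X (j + 1)) (d + ∑ t ∈ Finset.range j, (δ (t + 1) + n t)) *
        ((∏ i ∈ Finset.range j, racahKernel (n i) (X (i + 1)) (X (i + 2)) a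
          (d + ∑ t ∈ Finset.range i, (δ (t + 1) + n t)) (δ (i + 1))) * g) := by
  induction j generalizing X δ E d n with
  | zero => simp [pathSum_zero]
  | succ j ih =>
    have hsum : ∀ i, d + ∑ t ∈ Finset.range (i + 1), (δ (t + 1) + n t) =
        d + δ 1 + n 0 + ∑ t ∈ Finset.range i, (sigma 1 δ (t + 1) + (n (t + 1) : F)) := fun i => by
      rw [Finset.sum_range_succ']
      simp only [sigma]
      ring
    have ih' := ih h.sigma_one (d := d + δ 1 + n 0) (fun i => ha (i + 1))
      (fun i => by simp [sigma, hd (i + 1), h.δ (i + 1) 0]) (fun t => n (t + 1))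
      (fun i hi => hg (i + 1) (by omega))
    rw [Finset.prod_range_succ']
    simp only [hsum, Finset.range_zero, Finset.sum_empty, add_zero, zero_add]
    simp only [sigma, add_assoc, Nat.reduceAdd] at ih' ⊢
    rw [mul_comm (∏ _ ∈ _, _), mul_assoc, h.pathSum_racahKernel_mul ha hd, ← mul_assoc]
    · simp only [add_assoc] at ih' ⊢
      erw [ih']
      ring
    · rw [map_mul, map_prod, hg 0 (by omega)]
      congr 1
      refine Finset.prod_congr rfl fun i _ => ?_
      have hX : ∀ i, E 1 (X (i + 2)) = X (i + 2) := fun i => by simpa using h.X 0 (i + 1)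
      have hδ : ∀ i, E 1 (δ (i + 1)) = δ (i + 1) := h.δ 0
      rw [map_racahKernel]
      simp [hX, hδ, ha 0, hd 0, map_sum]

/-- The constant 1 is the product of Racah polynomials of degree zero. -/
theorem pathSum_one (h : IsShiftFamily X δ E) {a d : F}
    (ha : ∀ i, E (i + 1) a = a) (hd : ∀ i, E (i + 1) d = d) (j : ℕ) :
    pathSum 0 a d X δ E j 1 =
      coupling 0 0 a (X (j + 1)) (d + ∑ t ∈ Finset.range j, δ (t + 1)) := by
  have := h.pathSum_prod_racahKernel ha hd (fun _ => 0) j (g := 1) (fun _ _ => map_one _)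
  simpa [racahKernel, racahCoeff] using this

end IsShiftFamily

end Eigenfunctions

/-! ### The Racah operators as path sums -/

section RacahOperator

variable {k F : Type*} [Field k] [Field F] [Algebra k F] [CharZero F]

theorem G_eq_pathWeight (x β : ℕ → F) {j : ℕ} (ν : Fin j → SignType) :
    G x β ν = coupling 0 (extNu ν 1) (x 0 + β 0 / 2) (x 1 + β 1 / 2) ((β 1 - β 0) / 2) *
      pathWeight j (fun i => x i + β i / 2) (fun i => (β (i + 1) - β i) / 2) ν := by
  have key : ∀ (j : ℕ) (x β : ℕ → F) (ν : Fin j → SignType),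
      2 ^ (Finset.univ.filter fun i => ν i = 0).card *
        (∏ i ∈ Finset.range j, B (extNu ν (i + 1)) (extNu ν (i + 2)) (x (i + 1)) (x (i + 2))
          (β (i + 1)) (β (i + 2))) *
        (∏ i ∈ Finset.range j, bFactor (extNu ν (i + 1)) (x (i + 1)) (β (i + 1)))⁻¹ =
      pathWeight j (fun i => x i + β i / 2) (fun i => (β (i + 1) - β i) / 2) ν := by
    intro j
    induction j with
    | zero => intro x β ν; simp [pathWeight]
    | succ j ih =>
      intro x β ν
      have hcard : (2 : F) ^ (Finset.univ.filter fun i => ν i = 0).card =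
          (if ν 0 = 0 then 2 else 1) *
            2 ^ (Finset.univ.filter fun i => Fin.tail ν i = 0).card := by
        have : ∀ {m : ℕ} (ν : Fin m → SignType),
            (2 : F) ^ (Finset.univ.filter fun i => ν i = 0).card =
              ∏ i, if ν i = 0 then 2 else 1 := fun ν => by
          rw [Finset.prod_ite, Finset.prod_const, Finset.prod_const_one, mul_one]
        rw [this, this, Fin.prod_univ_succ]
        rfl
      have ih' := ih (sigma 1 x) (sigma 1 β) (Fin.tail ν)
      simp only [sigma] at ih'
      rw [hcard, Finset.prod_range_succ', Finset.prod_range_succ', pathWeight]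
      simp only [extNu_succ_succ, zero_add, extNu_one, B_eq_coupling (ν 0)]
      change _ = _ * _ * pathWeight j (fun i => x (i + 1) + β (i + 1) / 2)
        (fun i => (β (i + 1 + 1) - β (i + 1)) / 2) (Fin.tail ν)
      rw [← ih', ← two_div_bFactor, mul_inv]
      ring
  have h0 : extNu ν 0 = 0 := by rw [extNu, dif_neg (by omega)]
  have hb : ∏ i ∈ Finset.Icc 1 j, bFactor (extNu ν i) (x i) (β i) =
      ∏ i ∈ Finset.range j, bFactor (extNu ν (i + 1)) (x (i + 1)) (β (i + 1)) := by
    rw [← Finset.Ico_add_one_right_eq_Icc, Finset.prod_Ico_eq_prod_range]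
    simp [add_comm]
  rw [G, hb, Finset.prod_range_succ', h0, zero_add, B_eq_coupling 0, ← key j x β ν]
  simp only [add_assoc, Nat.reduceAdd]
  ring

theorem racahL_apply (x β : ℕ → F) (E : ℕ → F ≃ₐ[k] F) (j : ℕ) (f : F) :
    racahL x β E j f =
      pathSum 0 (x 0 + β 0 / 2) ((β 1 - β 0) / 2) (fun i => x i + β i / 2)
        (fun i => (β (i + 1) - β i) / 2) E j f -
      pathSum 0 (x 0 + β 0 / 2) ((β 1 - β 0) / 2) (fun i => x i + β i / 2)
        (fun i => (β (i + 1) - β i) / 2) E j 1 * f := by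
  simp only [pathSum, ← G_eq_pathWeight, Finset.sum_mul, ← Finset.sum_sub_distrib]
  rw [racahL, LinearMap.sum_apply, Finset.sum_filter]
  refine Finset.sum_congr rfl fun ν _ => ?_
  split_ifs with hν
  · change G x β ν * (shiftBy E ν f - f) = _
    simp only [map_one]
    ring
  · have : shiftBy E ν = 1 := by
      rw [not_not.1 hν]
      simp [shiftBy]
    simp [this]

/-- With D = (β_{j+1} - β_0)/2, the sum of all G_ν contributes -D² + D, which cancels the constant
κ(0, β_{j+1} - β_0 - 1) = D² - D; what remains is the sum of two Casimir values minus the path sum.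
-/
theorem opTwo_apply (x β : ℕ → F) (E : ℕ → F ≃ₐ[k] F)
    (h : IsShiftFamily (fun i => x i + β i / 2) (fun i => (β (i + 1) - β i) / 2) E)
    (h0 : ∀ i, E (i + 1) (x 0 + β 0 / 2) = x 0 + β 0 / 2)
    (h1 : ∀ i, E (i + 1) ((β 1 - β 0) / 2) = (β 1 - β 0) / 2) (j : ℕ) (f : F) :
    opTwo x β E (j + 1) f =
      ((x 0 + β 0 / 2) ^ 2 - 1 / 4 + ((x (j + 1) + β (j + 1) / 2) ^ 2 - 1 / 4)) * f -
      pathSum 0 (x 0 + β 0 / 2) ((β 1 - β 0) / 2) (fun i => x i + β i / 2)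
        (fun i => (β (i + 1) - β i) / 2) E j f := by
  change -(racahL x β E j f) + kappa 0 (β (j + 1) - β 0 - 1) * f = _
  have hs : (β 1 - β 0) / 2 + ∑ t ∈ Finset.range j, (β (t + 1 + 1) - β (t + 1)) / 2 =
      (β (j + 1) - β 0) / 2 := by
    rw [← Finset.sum_div, Finset.sum_range_sub fun t => β (t + 1)]
    ring
  rw [racahL_apply, h.pathSum_one h0 h1, hs]
  change -(_ - (_ ^ 2 + _ ^ 2 - _ ^ 2 + _ - 1 / 2) * f) + _ = _
  rw [kappa]
  ring

end RacahOperator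

/-! ### Homomorphisms from enveloping algebras and tensor powers -/

section Envelope

attribute [local instance] LieRing.ofAssociativeRing

variable {k : Type*} [Field k] {A : Type*} [Ring A] [Algebra k A]

/-- The lift factors through the centralizer of T, by uniqueness of lifts. -/
theorem commute_lift {L : Type*} [LieRing L] [LieAlgebra k L] (f : L →ₗ⁅k⁆ A) {T : A}
    (h : ∀ J, Commute (f J) T) (x : UniversalEnvelopingAlgebra k L) :
    Commute (UniversalEnvelopingAlgebra.lift k f x) T := by
  let C := Subalgebra.centralizer k {T}
  let f' : L →ₗ⁅k⁆ C :=
    { toFun := fun J => ⟨f J, Subalgebra.mem_centralizer_iff k |>.2 fun y hy => by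
        rw [Set.mem_singleton_iff.1 hy]
        exact (h J).eq.symm⟩
      map_add' := fun a b => Subtype.ext (map_add f a b)
      map_smul' := fun c a => Subtype.ext (map_smul f c a)
      map_lie' := fun {a b} => Subtype.ext (LieHom.map_lie f a b) }
  have e : UniversalEnvelopingAlgebra.lift k f =
      C.val.comp (UniversalEnvelopingAlgebra.lift k f') := by
    apply UniversalEnvelopingAlgebra.hom_ext
    ext J
    simp [f']
  rw [e]
  exact ((Subalgebra.mem_centralizer_iff k).1 (UniversalEnvelopingAlgebra.lift k f' x).2 T
    (Set.mem_singleton T)).symm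

theorem prod_ofFn_mul {n : ℕ} (a b : Fin n → A) (h : ∀ i j, i ≠ j → Commute (a i) (b j)) :
    (List.ofFn fun i => a i * b i).prod = (List.ofFn a).prod * (List.ofFn b).prod := by
  induction n with
  | zero => simp
  | succ n ih =>
    have hc : Commute (List.ofFn fun i : Fin n => a i.succ).prod (b 0) :=
      Commute.list_prod_left _ _ fun x hx => by
        obtain ⟨i, rfl⟩ := List.mem_ofFn.1 hx
        exact h _ _ (Fin.succ_ne_zero i)
    simp only [List.ofFn_succ, List.prod_cons]
    rw [ih _ _ fun i j hij => h _ _ fun e => hij (Fin.succ_injective _ e), mul_assoc, mul_assoc,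
      ← mul_assoc (b 0), ← hc.eq, mul_assoc]

theorem prod_ofFn_mulSingle {n : ℕ} (i : Fin n) (a : A) :
    (List.ofFn fun j => (Pi.mulSingle i a : Fin n → A) j).prod = a := by
  induction n with
  | zero => exact i.elim0
  | succ n ih =>
    rw [List.ofFn_succ, List.prod_cons]
    refine Fin.cases ?_ (fun i => ?_) i
    · simp
    · have : (fun j : Fin n => (Pi.mulSingle i.succ a : Fin (n + 1) → A) j.succ) =
          fun j => (Pi.mulSingle i a : Fin n → A) j := by
        funext j
        simp [Pi.mulSingle_apply]
      rw [this, ih, Pi.mulSingle_eq_of_ne (Fin.succ_ne_zero i).symm, one_mul]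

/-- The homomorphism from a tensor power that is determined by homomorphisms of the factors with
commuting images. -/
def tensorLift {R : Type*} [Ring R] [Algebra k R] {n : ℕ} (φ : Fin n → R →ₐ[k] A)
    (h : ∀ i j, i ≠ j → ∀ x y, Commute (φ i x) (φ j y)) : (⨂[k] _ : Fin n, R) →ₐ[k] A :=
  PiTensorProduct.liftAlgHom
    ((MultilinearMap.mkPiAlgebraFin k n A).compLinearMap fun i => (φ i).toLinearMap)
    (by simp [MultilinearMap.compLinearMap_apply, MultilinearMap.mkPiAlgebraFin_apply])
    (fun x y => by
      simp only [MultilinearMap.compLinearMap_apply, MultilinearMap.mkPiAlgebraFin_apply,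
        Pi.mul_apply, AlgHom.toLinearMap_apply, map_mul]
      exact prod_ofFn_mul _ _ fun i j hij => h i j hij _ _)

theorem tensorLift_singleAlgHom {R : Type*} [Ring R] [Algebra k R] {n : ℕ}
    (φ : Fin n → R →ₐ[k] A) (h : ∀ i j, i ≠ j → ∀ x y, Commute (φ i x) (φ j y)) (i : Fin n)
    (x : R) : tensorLift φ h
      (PiTensorProduct.singleAlgHom (R := k) (A := fun _ : Fin n => R) i x) = φ i x := by
  have e : ∀ j, φ j ((Pi.mulSingle i x : Fin n → R) j) =
      (Pi.mulSingle i (φ i x) : Fin n → A) j := fun j => by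
    rcases eq_or_ne j i with rfl | hj
    · simp
    · simp [hj]
  change PiTensorProduct.lift _ (PiTensorProduct.tprod k (Pi.mulSingle i x : Fin n → R)) = _
  rw [PiTensorProduct.lift.tprod, MultilinearMap.compLinearMap_apply,
    MultilinearMap.mkPiAlgebraFin_apply]
  simp only [AlgHom.toLinearMap_apply, e]
  exact prod_ofFn_mulSingle i _

end Envelope

/-! ### Representations of su(1,1) at the sites and the map on the tensor power -/

section Site

attribute [local instance] LieRing.ofAssociativeRing

variable {k F : Type*} [Field k] [CharZero k] [Field F] [Algebra k F]

/-- The representation of `su(1,1)` given by operators `S` with the bracket relations of a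
vector. -/
def siteHom (S : Fin 2 → Fin 2 → Module.End k F) (hS : ∀ i j, S i j = S j i)
    (h : IsVector S S) : su11 k →ₗ⁅k⁆ Module.End k F where
  toFun M := (2 * M.val 0 0) • opJ0 S + M.val 0 1 • opJp S - M.val 1 0 • opJm S
  map_add' M M' := by
    simp only [AddMemClass.coe_add, Matrix.add_apply]
    module
  map_smul' c M := by
    simp only [SetLike.val_smul, Matrix.smul_apply, smul_eq_mul, RingHom.id_apply]
    module
  map_lie' {M M'} := by
    have htr : ∀ M : su11 k, M.val 1 1 = -M.val 0 0 := fun M => by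
      have h2 : Matrix.trace M.val = 0 := by
        simpa [LieAlgebra.SpecialLinear.sl, LinearMap.mem_ker] using M.property
      rw [Matrix.trace, Fin.sum_univ_two] at h2
      exact eq_neg_of_add_eq_zero_right h2
    ext f
    have h1 := h 0 1 0 0 f
    have h2 := h 0 1 1 1 f
    have h3 := h 1 1 0 0 f
    simp only [eps_self, eps_zero_one, eps_one_zero, zero_smul, add_zero, one_smul, neg_smul,
      hS 1 0] at h1 h2 h3
    simp only [LieAlgebra.SpecialLinear.sl_bracket, Ring.lie_def, Matrix.sub_apply,
      Matrix.mul_apply, Fin.sum_univ_two, htr, LinearMap.sub_apply, LinearMap.add_apply,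
      LinearMap.smul_apply, Module.End.mul_apply, map_add, map_sub, map_smul, opJ0, opJp, opJm,
      h1, h2, h3]
    module

variable {S : Fin 2 → Fin 2 → Module.End k F} (hS : ∀ i j, S i j = S j i) (h : IsVector S S)

theorem siteHom_J0 : siteHom S hS h (J0 k) = opJ0 S := by
  change (2 * (J0 k).val 0 0) • opJ0 S + (J0 k).val 0 1 • opJp S - (J0 k).val 1 0 • opJm S = _
  simp [J0]

theorem siteHom_Jp : siteHom S hS h (Jp k) = opJp S := by
  change (2 * (Jp k).val 0 0) • opJ0 S + (Jp k).val 0 1 • opJp S - (Jp k).val 1 0 • opJm S = _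
  simp [Jp]

theorem siteHom_Jm : siteHom S hS h (Jm k) = opJm S := by
  change (2 * (Jm k).val 0 0) • opJ0 S + (Jm k).val 0 1 • opJp S - (Jm k).val 1 0 • opJm S = _
  simp [Jm]
  module

/-- There is a homomorphism from `U(su(1,1))^{⊗ n}` for commuting families of operators with the
bracket relations of `su(1,1)`; it maps `C_K` to the Casimir operator of the sum over `K`. -/
theorem exists_tensorHom {n : ℕ} (S : Fin n → Fin 2 → Fin 2 → Module.End k F)
    (hS : ∀ m i j, S m i j = S m j i) (h : ∀ m, IsVector (S m) (S m))
    (hc : ∀ m m', m ≠ m' → ∀ i j a b, Commute (S m i j) (S m' a b)) :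
    ∃ Φ : UTensor k n →ₐ[k] Module.End k F,
      ∀ K, Φ (casimir K) = opCasimir (∑ m ∈ K, S m) := by
  let ρ : ∀ m, su11 k →ₗ⁅k⁆ Module.End k F := fun m => siteHom (S m) (hS m) (h m)
  have hρ : ∀ m m', m ≠ m' → ∀ x y, Commute (ρ m x) (ρ m' y) := fun m m' hm x y => by
    have hc' := hc m m' hm
    change Commute (_ • opJ0 (S m) + _ • opJp (S m) - _ • opJm (S m))
      (_ • opJ0 (S m') + _ • opJp (S m') - _ • opJm (S m'))
    refine Commute.sub_left (Commute.add_left ?_ ?_) ?_ <;>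
      refine Commute.sub_right (Commute.add_right ?_ ?_) ?_ <;>
      exact (((hc' _ _ _ _).smul_left _).smul_right _ |>.smul_left _).smul_right _
  have hφ : ∀ m m', m ≠ m' → ∀ x y, Commute (UniversalEnvelopingAlgebra.lift k (ρ m) x)
      (UniversalEnvelopingAlgebra.lift k (ρ m') y) := fun m m' hm x y =>
    commute_lift _ (fun J => (commute_lift _ (fun J' => (hρ m m' hm J J').symm) y).symm) x
  let Φ := tensorLift (fun m => UniversalEnvelopingAlgebra.lift k (ρ m)) hφ
  have hJ : ∀ J (K : Finset (Fin n)), Φ (JSum J K) = ∑ m ∈ K, ρ m J := fun J K => by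
    rw [JSum, map_sum]
    refine Finset.sum_congr rfl fun m _ => ?_
    rw [tensorLift_singleAlgHom, UniversalEnvelopingAlgebra.lift_ι_apply]
  refine ⟨Φ, fun K => ?_⟩
  have e0 : ∑ m ∈ K, ρ m (J0 k) = opJ0 (∑ m ∈ K, S m) := by
    simp only [ρ, siteHom_J0, opJ0, ← Finset.smul_sum, Finset.sum_apply]
  have ep : ∑ m ∈ K, ρ m (Jp k) = opJp (∑ m ∈ K, S m) := by
    simp only [ρ, siteHom_Jp, opJp, ← Finset.smul_sum, Finset.sum_apply]
  have em : ∑ m ∈ K, ρ m (Jm k) = opJm (∑ m ∈ K, S m) := by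
    simp only [ρ, siteHom_Jm, opJm, ← Finset.smul_sum, Finset.sum_apply]
  rw [casimir, map_sub, map_sub, map_pow, map_mul, hJ, hJ, hJ, e0, ep, em, opCasimir]

end Site

/-! ### Generation by interval Casimirs -/

section Generation

variable {k : Type*} [Field k] {n : ℕ}

theorem JSum_union {K L : Finset (Fin n)} (h : Disjoint K L) (J : su11 k) :
    JSum J (K ∪ L) = JSum J K + JSum J L := Finset.sum_union h

/-- The mixed part of `C_{K ∪ L}`. -/
def mixedCasimir (K L : Finset (Fin n)) : UTensor k n :=
  JSum (J0 k) K * JSum (J0 k) L + JSum (J0 k) L * JSum (J0 k) K -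
    JSum (Jp k) K * JSum (Jm k) L - JSum (Jp k) L * JSum (Jm k) K

theorem casimir_union {K L : Finset (Fin n)} (h : Disjoint K L) :
    (casimir (K ∪ L) : UTensor k n) = casimir K + casimir L + mixedCasimir K L := by
  simp only [casimir, mixedCasimir, JSum_union h]
  noncomm_ring

theorem mixedCasimir_comm (K L : Finset (Fin n)) :
    (mixedCasimir K L : UTensor k n) = mixedCasimir L K := by
  simp only [mixedCasimir]
  abel

theorem mixedCasimir_union_left {K L M : Finset (Fin n)} (h : Disjoint K L) :
    (mixedCasimir (K ∪ L) M : UTensor k n) = mixedCasimir K M + mixedCasimir L M := by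
  simp only [mixedCasimir, JSum_union h]
  noncomm_ring

theorem casimir_empty : (casimir (∅ : Finset (Fin n)) : UTensor k n) = 0 := by
  simp [casimir, JSum]

theorem mixedCasimir_empty_left (L : Finset (Fin n)) :
    (mixedCasimir ∅ L : UTensor k n) = 0 := by
  simp [mixedCasimir, JSum]

theorem casimir_interval_mem (A : Subalgebra k (UTensor k n))
    (hA : ∀ p q, 1 ≤ p → p ≤ q → q ≤ n → casimir (interval n p q) ∈ A)
    (p q : ℕ) : casimir (interval n (p + 1) q) ∈ A := by
  rcases Nat.lt_or_ge p (min q n) with h | h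
  · have e : interval n (p + 1) q = interval n (p + 1) (min q n) := by
      ext i
      have := i.2
      simp only [interval, Finset.mem_filter, Finset.mem_univ, true_and]
      omega
    rw [e]
    exact hA _ _ (by omega) (by omega) (by omega)
  · have e : interval n (p + 1) q = ∅ := by
      refine Finset.filter_eq_empty_iff.2 fun i _ => ?_
      have := i.2
      omega
    rw [e, casimir_empty]
    exact zero_mem _

/-- Inclusion–exclusion over four intervals: both end points, one of them dropped, both dropped. The
elements i, j count from 0 and the bounds of `interval` from 1. -/
theorem mixedCasimir_singleton_mem (A : Subalgebra k (UTensor k n))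
    (hA : ∀ p q, 1 ≤ p → p ≤ q → q ≤ n → casimir (interval n p q) ∈ A)
    {i j : Fin n} (hij : i < j) :
    mixedCasimir {i} {j} ∈ A := by
  have hd1 : Disjoint ({i} : Finset (Fin n)) (interval n (i + 2) j) := by
    simp [interval]
  have hd2 : Disjoint (interval n (i + 2) j) ({j} : Finset (Fin n)) := by
    simp [interval]
  have hd3 : Disjoint ({i} : Finset (Fin n)) {j} := by simpa using hij.ne
  have hd4 : Disjoint ({i} ∪ interval n (i + 2) j) ({j} : Finset (Fin n)) :=
    Finset.disjoint_union_left.2 ⟨hd3, hd2⟩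
  have e1 : interval n (i + 1) j = {i} ∪ interval n (i + 2) j := by
    ext m
    simp only [interval, Finset.mem_filter, Finset.mem_union, Finset.mem_singleton,
      Finset.mem_univ, true_and, Fin.ext_iff]
    have := Fin.lt_def.1 hij
    omega
  have e2 : interval n (i + 2) (j + 1) = interval n (i + 2) j ∪ {j} := by
    ext m
    simp only [interval, Finset.mem_filter, Finset.mem_union, Finset.mem_singleton,
      Finset.mem_univ, true_and, Fin.ext_iff]
    have := Fin.lt_def.1 hij
    omega
  have e3 : interval n (i + 1) (j + 1) = {i} ∪ interval n (i + 2) j ∪ {j} := by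
    ext m
    simp only [interval, Finset.mem_filter, Finset.mem_union, Finset.mem_singleton,
      Finset.mem_univ, true_and, Fin.ext_iff]
    have := Fin.lt_def.1 hij
    omega
  have key : mixedCasimir {i} {j} = (casimir (interval n (i + 1) (j + 1)) : UTensor k n) -
      casimir (interval n (i + 1) j) - casimir (interval n (i + 2) (j + 1)) +
      casimir (interval n (i + 2) j) := by
    rw [e3, e1, e2, casimir_union hd4, casimir_union hd2, mixedCasimir_union_left hd1]
    abel
  rw [key]
  exact add_mem (sub_mem (sub_mem (casimir_interval_mem A hA _ _) (casimir_interval_mem A hA _ _))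
    (casimir_interval_mem A hA _ _)) (casimir_interval_mem A hA _ _)

/-- The elements `C_K` belong to every subalgebra that contains those of the intervals. -/
theorem casimir_mem_of_interval_mem (A : Subalgebra k (UTensor k n))
    (hA : ∀ p q, 1 ≤ p → p ≤ q → q ≤ n → casimir (interval n p q) ∈ A)
    (K : Finset (Fin n)) : casimir K ∈ A := by
  have hsing : ∀ i : Fin n, casimir {i} ∈ A := fun i => by
    have e : ({i} : Finset (Fin n)) = interval n (i + 1) (i + 1) := by
      ext m
      simp only [interval, Finset.mem_filter, Finset.mem_singleton, Finset.mem_univ, true_and,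
        Fin.ext_iff]
      omega
    rw [e]
    exact casimir_interval_mem A hA _ _
  have hmix : ∀ i (K : Finset (Fin n)), i ∉ K → mixedCasimir K {i} ∈ A := fun i K => by
    induction K using Finset.induction_on with
    | empty => intro _; rw [mixedCasimir_empty_left]; exact zero_mem _
    | insert a K ha ih =>
      intro hi
      rw [Finset.mem_insert, not_or] at hi
      rw [Finset.insert_eq, mixedCasimir_union_left (by simpa using ha)]
      refine add_mem ?_ (ih hi.2)
      rcases lt_or_gt_of_ne hi.1 with h | h
      · rw [mixedCasimir_comm]
        exact mixedCasimir_singleton_mem A hA h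
      · exact mixedCasimir_singleton_mem A hA h
  induction K using Finset.induction_on with
  | empty => rw [casimir_empty]; exact zero_mem _
  | insert a K ha ih =>
    -- Biadditivity of the mixed part reduces it to pairs of single sites, the content of `hmix`.
    rw [Finset.insert_eq, casimir_union (by simpa using ha), mixedCasimir_comm]
    exact add_mem (add_mem (hsing a) ih) (hmix a K ha)

end Generation

/-! ### Site generators as differences of total generators -/

section Sites

variable {k F : Type*} [Field k] [Field F] [Algebra k F]

/-- Schematically [T,T] = T and [T,S] = [S,T] = [S,S] = S, so [T - S, T - S] = T - S; the bracket
[S,T] is read off from `h` with the roles exchanged. -/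
theorem IsVector.sub_self {S T : Fin 2 → Fin 2 → Module.End k F} (hT : IsVector T T)
    (hS : IsVector S S) (h : IsVector T S) (hs : ∀ i j, S i j = S j i) :
    IsVector (T - S) (T - S) := by
  intro i j a b f
  have e := h a b i j f
  rw [hs a j, hs b j, add_assoc, add_assoc, add_assoc, ← sub_eq_iff_eq_add] at e
  simp only [Pi.sub_apply, LinearMap.sub_apply, map_sub]
  rw [← e, hT i j a b, hS i j a b, h i j a b, hs a i, hs a j, eps_swap i b, eps_swap i a,
    eps_swap j b, eps_swap j a]
  module

/-- T' and S' act on T and S in the same way, so their difference acts by zero. -/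
theorem IsVector.commute_sub {S T S' T' : Fin 2 → Fin 2 → Module.End k F} (h1 : IsVector T' T)
    (h2 : IsVector T' S) (h3 : IsVector S' T) (h4 : IsVector S' S) (i j a b : Fin 2) :
    Commute ((T' - S') i j) ((T - S) a b) := by
  refine LinearMap.ext fun f => ?_
  simp only [Pi.sub_apply, LinearMap.sub_apply, map_sub, Module.End.mul_apply]
  rw [h1, h2, h3, h4]
  module

variable (H : HalfShifts k F) (N : ℕ)

/-- The total generators of the first `m` sites. -/
def HalfShifts.partialTotal : ℕ → Fin 2 → Fin 2 → Module.End k F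
  | 0 => 0
  | m + 1 => H.total N m

/-- The generators of a single site. -/
def HalfShifts.site (m : ℕ) : Fin 2 → Fin 2 → Module.End k F :=
  H.partialTotal N (m + 1) - H.partialTotal N m

namespace HalfShifts

variable {N}

theorem partialTotal_symm (m : ℕ) (i j : Fin 2) :
    H.partialTotal N m i j = H.partialTotal N m j i := by
  cases m with
  | zero => rfl
  | succ m => exact H.total_symm m i j

theorem isVector_partialTotal [CharZero F] {m m' : ℕ} (hm : m' ≤ N + 1) (h : m ≤ m') :
    IsVector (H.partialTotal N m') (H.partialTotal N m) := by
  cases m with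
  | zero =>
    intro i j a b f
    simp [partialTotal]
  | succ m =>
    obtain ⟨m', rfl⟩ : ∃ t, m' = t + 1 := ⟨m' - 1, by omega⟩
    exact H.isVector_total (by omega) (by omega)

theorem isVector_site [CharZero F] {m : ℕ} (hm : m ≤ N) : IsVector (H.site N m) (H.site N m) :=
  (H.isVector_partialTotal (by omega) le_rfl).sub_self
    (H.isVector_partialTotal (by omega) le_rfl) (H.isVector_partialTotal (by omega) (by omega))
    (H.partialTotal_symm m)

theorem commute_site [CharZero F] {m m' : ℕ} (hm : m ≤ N) (hm' : m' ≤ N) (h : m ≠ m')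
    (i j a b : Fin 2) :
    Commute (H.site N m i j) (H.site N m' a b) := by
  have key : ∀ {m m' : ℕ}, m' ≤ N → m < m' → ∀ i j a b,
      Commute (H.site N m' i j) (H.site N m a b) := fun hm' h i j a b =>
    IsVector.commute_sub (H.isVector_partialTotal (by omega) (by omega))
      (H.isVector_partialTotal (by omega) (by omega))
      (H.isVector_partialTotal (by omega) (by omega))
      (H.isVector_partialTotal (by omega) (by omega)) i j a b
  rcases lt_or_gt_of_ne h with h | h
  · exact (key hm' h a b i j).symm
  · exact key hm h i j a b

theorem site_symm (m : ℕ) (i j : Fin 2) : H.site N m i j = H.site N m j i := by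
  simp only [site, Pi.sub_apply, H.partialTotal_symm _ i j]

theorem sum_site_interval {n p q : ℕ} (hpq : p ≤ q) (hq : q ≤ n) :
    ∑ m ∈ interval n (p + 1) q, H.site N m = H.partialTotal N q - H.partialTotal N p := by
  rw [interval, Finset.sum_filter,
    Fin.sum_univ_eq_sum_range (fun m => if p + 1 ≤ m + 1 ∧ m + 1 ≤ q then H.site N m else 0) n,
    ← Finset.sum_filter]
  have e : (Finset.range n).filter (fun m => p + 1 ≤ m + 1 ∧ m + 1 ≤ q) = Finset.Ico p q := by
    ext m
    simp only [Finset.mem_filter, Finset.mem_range, Finset.mem_Ico]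
    omega
  rw [e]
  exact Finset.sum_Ico_sub (H.partialTotal N) hpq

end HalfShifts

end Sites

/-! ### The model on rational functions -/

section RationalFunctions

variable (k : Type*) [Field k]

theorem ratFun_algEquiv_ext {φ ψ : RatFun k ≃ₐ[k] RatFun k}
    (h : ∀ i, φ (algebraMap (MvPolynomial ℕ k) (RatFun k) (MvPolynomial.X i)) =
      ψ (algebraMap (MvPolynomial ℕ k) (RatFun k) (MvPolynomial.X i))) : φ = ψ := by
  have e : (φ.toAlgHom.comp (IsScalarTower.toAlgHom k (MvPolynomial ℕ k) (RatFun k))) =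
      (ψ.toAlgHom.comp (IsScalarTower.toAlgHom k (MvPolynomial ℕ k) (RatFun k))) :=
    MvPolynomial.algHom_ext h
  have e2 : (φ : RatFun k →+* RatFun k) = (ψ : RatFun k →+* RatFun k) :=
    IsLocalization.ringHom_ext (nonZeroDivisors (MvPolynomial ℕ k))
      (RingHom.ext fun p => DFunLike.congr_fun e p)
  exact AlgEquiv.ext fun f => DFunLike.congr_fun e2 f

theorem shiftOp_X (i j : ℕ) :
    shiftOp k i (algebraMap (MvPolynomial ℕ k) (RatFun k) (MvPolynomial.X j)) =
      algebraMap (MvPolynomial ℕ k) (RatFun k) (MvPolynomial.X j) + if j = i then 1 else 0 := by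
  rw [shiftOp, IsFractionRing.algEquivOfAlgEquiv_algebraMap]
  simp only [polyShift, AlgEquiv.ofAlgHom_apply, MvPolynomial.aeval_X]
  split_ifs <;> simp

/-- The automorphism `x_i ↦ x_i + 1/2` of the polynomial ring. -/
def polyHalfShift (i : ℕ) : MvPolynomial ℕ k ≃ₐ[k] MvPolynomial ℕ k :=
  AlgEquiv.ofAlgHom
    (MvPolynomial.aeval fun l => MvPolynomial.X l + if l = i then MvPolynomial.C (1 / 2) else 0)
    (MvPolynomial.aeval fun l => MvPolynomial.X l - if l = i then MvPolynomial.C (1 / 2) else 0)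
    (by ext l : 1; by_cases h : l = i <;> simp [h, MvPolynomial.algebraMap_eq])
    (by ext l : 1; by_cases h : l = i <;> simp [h, MvPolynomial.algebraMap_eq])

/-- The automorphism `x_i ↦ x_i + 1/2` of the field of rational functions. -/
def halfShift (i : ℕ) : RatFun k ≃ₐ[k] RatFun k :=
  IsFractionRing.algEquivOfAlgEquiv (polyHalfShift k i)

theorem halfShift_X (i j : ℕ) :
    halfShift k i (algebraMap (MvPolynomial ℕ k) (RatFun k) (MvPolynomial.X j)) =
      algebraMap (MvPolynomial ℕ k) (RatFun k) (MvPolynomial.X j) +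
        if j = i then 1 / 2 else 0 := by
  have hC : algebraMap (MvPolynomial ℕ k) (RatFun k) (MvPolynomial.C (1 / 2)) = 1 / 2 := by
    rw [← MvPolynomial.algebraMap_eq, ← IsScalarTower.algebraMap_apply, map_div₀, map_one,
      map_ofNat]
  rw [halfShift, IsFractionRing.algEquivOfAlgEquiv_algebraMap]
  simp only [polyHalfShift, AlgEquiv.ofAlgHom_apply, MvPolynomial.aeval_X]
  split_ifs
  · rw [map_add, hC]
  · simp

/-- Half-shifts are needed only for the spinors; path sums contain their squares, the given shift
operators. -/
theorem halfShift_mul_self [CharZero k] (i : ℕ) : halfShift k i * halfShift k i = shiftOp k i := by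
  refine ratFun_algEquiv_ext k fun j => ?_
  rw [AlgEquiv.mul_apply, halfShift_X, map_add, halfShift_X, shiftOp_X]
  split_ifs
  · rw [map_div₀, map_one, map_ofNat]
    ring
  · simp

theorem halfShift_comm (i j : ℕ) :
    halfShift k i * halfShift k j = halfShift k j * halfShift k i := by
  refine ratFun_algEquiv_ext k fun l => ?_
  simp only [AlgEquiv.mul_apply, halfShift_X, map_add]
  split_ifs <;> simp [map_ofNat]

variable {k}

theorem halfShift_param (β : ℕ → k) (i j : ℕ) : halfShift k i (param β j) = param β j :=
  AlgEquiv.commutes _ _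

theorem halfShift_xvar (i j : ℕ) :
    halfShift k (i + 1) (xvar k j) = xvar k j + if j = i + 1 then 1 / 2 else 0 := by
  rcases Nat.eq_zero_or_pos j with rfl | hj
  · simp [xvar]
  · simp only [xvar, if_neg hj.ne']
    rw [halfShift_X]

theorem shiftOp_param (β : ℕ → k) (i j : ℕ) : shiftOp k i (param β j) = param β j := by
  simp [param]

theorem shiftOp_xvar (i j : ℕ) :
    shiftOp k (i + 1) (xvar k j) = xvar k j + if j = i + 1 then 1 else 0 := by
  rcases Nat.eq_zero_or_pos j with rfl | hj
  · simp [xvar]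
  · simp only [xvar, if_neg hj.ne']
    rw [shiftOp_X]

variable [CharZero k]

/-- The half-integer shifts on rational functions, with `X_i = x_i + β_i / 2`. -/
def ratFunHalfShifts (β : ℕ → k) : HalfShifts k (RatFun k) where
  X i := xvar k i + param β i / 2
  δ i := (param β (i + 1) - param β i) / 2
  e i := halfShift k (i + 1)
  e_X i j := by
    rw [map_add, map_div₀, halfShift_param, map_ofNat, halfShift_xvar]
    ring
  e_δ i j := by rw [map_div₀, map_sub, halfShift_param, halfShift_param, map_ofNat]
  e_comm i j f := by rw [← AlgEquiv.mul_apply, halfShift_comm, AlgEquiv.mul_apply]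

theorem shiftOp_succ (β : ℕ → k) (i : ℕ) :
    shiftOp k (i + 1) = (ratFunHalfShifts β).e i * (ratFunHalfShifts β).e i :=
  (halfShift_mul_self k (i + 1)).symm

theorem isShiftFamily_sigma (β : ℕ → k) (s : ℕ) :
    IsShiftFamily (fun i => sigma s (xvar k) i + sigma s (param β) i / 2)
      (fun i => (sigma s (param β) (i + 1) - sigma s (param β) i) / 2) (sigma s (shiftOp k)) := by
  refine ⟨fun i j => ?_, fun i j => ?_, fun i j => ?_⟩
  · simp only [sigma, show i + 1 + s = i + s + 1 by omega]
    rw [map_add, map_div₀, shiftOp_param, shiftOp_xvar, map_ofNat]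
    simp only [show j + 1 + s = i + s + 1 ↔ i = j by omega]
    ring
  · simp [sigma, shiftOp_param, map_ofNat]
  · simp only [sigma, show ∀ i, i + 1 + s = i + s + 1 by omega]
    rw [shiftOp_succ β, shiftOp_succ β]
    have h : ∀ i j, Commute ((ratFunHalfShifts β).e i) ((ratFunHalfShifts β).e j) := fun i j =>
      halfShift_comm k (i + 1) (j + 1)
    exact ((h _ _).mul_right (h _ _)).mul_left ((h _ _).mul_right (h _ _))

theorem opCasimir_partialTotal (β : ℕ → k) {N m : ℕ} :
    opCasimir ((ratFunHalfShifts β).partialTotal N (m + 1)) = opInitial β (m + 1) := by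
  ext f
  rw [HalfShifts.partialTotal, HalfShifts.opCasimir_total]
  change ((xvar k m + param β m / 2) ^ 2 - 1 / 4) * f = kappa (xvar k m) (param β m) * f
  rw [kappa]
  ring

theorem opInterval_apply (β : ℕ → k) (l j : ℕ) (f : RatFun k) :
    opInterval β (l + 2) (l + j + 2) f =
      ((xvar k l + param β l / 2) ^ 2 - 1 / 4 +
        ((xvar k (l + j + 1) + param β (l + j + 1) / 2) ^ 2 - 1 / 4)) * f -
      pathSum 0 (sigma l (xvar k) 0 + sigma l (param β) 0 / 2)
        ((sigma l (param β) 1 - sigma l (param β) 0) / 2)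
        (fun i => sigma l (xvar k) i + sigma l (param β) i / 2)
        (fun i => (sigma l (param β) (i + 1) - sigma l (param β) i) / 2)
        (sigma l (shiftOp k)) j f := by
  have h0 : ∀ i, sigma l (shiftOp k) (i + 1) (sigma l (xvar k) 0 + sigma l (param β) 0 / 2) =
      sigma l (xvar k) 0 + sigma l (param β) 0 / 2 := fun i => by
    simp only [sigma, show i + 1 + l = i + l + 1 by omega, map_add, map_div₀, shiftOp_param,
      shiftOp_xvar, map_ofNat]
    rw [if_neg (by omega), add_zero]
  have h1 : ∀ i, sigma l (shiftOp k) (i + 1)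
      ((sigma l (param β) 1 - sigma l (param β) 0) / 2) =
        (sigma l (param β) 1 - sigma l (param β) 0) / 2 := fun i => by
    simp [sigma, shiftOp_param, map_ofNat]
  rw [opInterval, show l + j + 2 - (l + 2) + 1 = j + 1 by omega, show l + 2 - 2 = l by omega,
    opTwo_apply _ _ _ (isShiftFamily_sigma β l) h0 h1]
  simp only [sigma, zero_add, show j + 1 + l = l + j + 1 by omega]

theorem opCasimir_partialTotal_sub (β : ℕ → k) {N l j : ℕ} (h : l + j < N) :
    opCasimir ((ratFunHalfShifts β).partialTotal N (l + j + 2) -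
      (ratFunHalfShifts β).partialTotal N (l + 1)) = opInterval β (l + 2) (l + j + 2) := by
  set H := ratFunHalfShifts β with hH
  ext f
  change opCasimir (H.total N (l + j + 1) - H.total N l) f = _
  rw [opCasimir_sub (H.isVector_total (by omega) (by omega)) (H.total_symm l),
    LinearMap.sub_apply, LinearMap.add_apply, H.opCasimir_total, H.opCasimir_total,
    opInterval_apply,
    H.opDot_total l j h (fun i => sigma l (xvar k) i + sigma l (param β) i / 2)
      (fun i => (sigma l (param β) (i + 1) - sigma l (param β) i) / 2) (sigma l (shiftOp k))
      (fun i => ?_) (fun i => ?_) (fun i => ?_)]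
  · change ((xvar k (l + j + 1) + param β (l + j + 1) / 2) ^ 2 - 1 / 4) * f +
      ((xvar k l + param β l / 2) ^ 2 - 1 / 4) * f - _ = _
    ring
  · simp only [sigma, add_comm i l]
    rfl
  · simp only [sigma, show i + 1 + l = l + i + 1 by omega, add_comm i l]
    rfl
  · simp only [sigma, show i + 1 + l = l + i + 1 by omega]
    exact shiftOp_succ β (l + i)

theorem partialSum_succ (s : ℕ → ℕ) (j : ℕ) : partialSum s (j + 1) = partialSum s j + s (j + 1) :=
  Finset.sum_Icc_succ_top (by omega) _

theorem add_sum_degree (β : ℕ → k) (s : ℕ → ℕ) (j : ℕ) :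
    (param β 1 - param β 0) / 2 + ∑ t ∈ Finset.range j,
      ((param β (t + 2) - param β (t + 1)) / 2 + (s (t + 1) : RatFun k)) =
      (param β (j + 1) - param β 0) / 2 + (partialSum s j : RatFun k) := by
  induction j with
  | zero => simp [partialSum]
  | succ j ih =>
    rw [Finset.sum_range_succ, ← add_assoc, ih, partialSum_succ]
    push_cast
    ring

theorem multiRacah_eq (n : ℕ) (β : ℕ → k) (s : ℕ → ℕ) :
    multiRacah n (xvar k) (param β) s = ∏ i ∈ Finset.range (n - 2),
      racahKernel (s (i + 1)) (xvar k (i + 1) + param β (i + 1) / 2)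
        (xvar k (i + 2) + param β (i + 2) / 2) (param β 0 / 2)
        ((param β 1 - param β 0) / 2 + ∑ t ∈ Finset.range i,
          ((param β (t + 2) - param β (t + 1)) / 2 + (s (t + 1) : RatFun k)))
        ((param β (i + 2) - param β (i + 1)) / 2) := by
  rw [multiRacah, ← Finset.Ico_add_one_right_eq_Icc, Finset.prod_Ico_eq_prod_range]
  refine Finset.prod_congr (by simp) fun i _ => ?_
  rw [add_sum_degree, ← racahPoly_eq_racahKernel]
  simp only [add_comm 1 i, add_tsub_cancel_right]

theorem opInterval_multiRacah (n : ℕ) (β : ℕ → k) (s : ℕ → ℕ) {j : ℕ} (hj : j + 2 ≤ n) :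
    opInterval β 2 (j + 2) (multiRacah n (xvar k) (param β) s) =
      kappa (partialSum s j : RatFun k) (param β (j + 1) - param β 0 - 1) *
        multiRacah n (xvar k) (param β) s := by
  obtain ⟨r, hr⟩ : ∃ r, n - 2 = j + r := ⟨n - 2 - j, by omega⟩
  have h0 : ∀ i, shiftOp k (i + 1) (param β 0 / 2) = param β 0 / 2 := fun i => by
    rw [map_div₀, shiftOp_param, map_ofNat]
  have h1 : ∀ i, shiftOp k (i + 1) ((param β 1 - param β 0) / 2) =
      (param β 1 - param β 0) / 2 := fun i => by
    rw [map_div₀, map_sub, shiftOp_param, shiftOp_param, map_ofNat]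
  rw [multiRacah_eq, hr, Finset.prod_range_add]
  set K : ℕ → RatFun k := fun i => racahKernel (s (i + 1)) (xvar k (i + 1) + param β (i + 1) / 2)
    (xvar k (i + 2) + param β (i + 2) / 2) (param β 0 / 2)
    ((param β 1 - param β 0) / 2 + ∑ t ∈ Finset.range i,
      ((param β (t + 2) - param β (t + 1)) / 2 + (s (t + 1) : RatFun k)))
    ((param β (i + 2) - param β (i + 1)) / 2) with hK
  -- The remaining factors involve only x_{j+1} and later variables, and the earlier degrees only as
  -- constants, so the shifts in x_1, …, x_j fix them.
  have hg : ∀ i < j, shiftOp k (i + 1) (∏ t ∈ Finset.range r, K (j + t)) =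
      ∏ t ∈ Finset.range r, K (j + t) := fun i hi => by
    rw [map_prod]
    refine Finset.prod_congr rfl fun t _ => ?_
    simp only [hK, add_sum_degree]
    rw [map_racahKernel]
    simp only [map_add, map_sub, map_div₀, map_ofNat, map_natCast, shiftOp_param, shiftOp_xvar]
    rw [if_neg (by omega), if_neg (by omega), add_zero, add_zero]
  have key := (isShiftFamily_sigma β 0).pathSum_prod_racahKernel h0 h1 (fun t => s (t + 1)) j hg
  have hx : xvar k 0 = 0 := rfl
  have e := opInterval_apply β 0 j
    ((∏ t ∈ Finset.range j, K t) * ∏ t ∈ Finset.range r, K (j + t))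
  simp only [zero_add, sigma, add_zero, hx] at e key
  refine e.trans ?_
  erw [key]
  -- Here D = (β_{j+1} - β_0)/2 + |s|_j, and the eigenvalue D² - D is the required κ.
  rw [add_sum_degree, show ∀ a Y D : RatFun k, coupling 0 0 a Y D =
    a ^ 2 + Y ^ 2 - D ^ 2 + D - 1 / 2 from fun _ _ _ => rfl, kappa]
  ring

end RationalFunctions

/-! ### Assembly of the realization and its image -/

/-- The discrete realization, defined on the whole tensor power. -/
theorem exists_realization {k : Type*} [Field k] [CharZero k] (n : ℕ) (β : ℕ → k) :
    ∃ Φ : UTensor k n →ₐ[k] Module.End k (RatFun k),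
      (∀ m, 1 ≤ m → m ≤ n → Φ (casimir (interval n 1 m)) = opInitial β m) ∧
      (∀ p q, 2 ≤ p → p ≤ q → q ≤ n → Φ (casimir (interval n p q)) = opInterval β p q) ∧
      (racahAlgebra k n).map Φ = discreteAlgebra n β := by
  obtain ⟨Φ, hΦ⟩ := exists_tensorHom
    -- The top level is n - 1 because T_0, …, T_{n-1} are the n totals; X_n and X_{n+1} serve as
    -- auxiliary coordinates of its spinors and do not enter the interval Casimirs.
    (fun m : Fin n => (ratFunHalfShifts β).site (n - 1) m)
    (fun m => HalfShifts.site_symm _ _) (fun m => HalfShifts.isVector_site _ (by omega))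
    (fun m m' h => HalfShifts.commute_site _ (by omega) (by omega) (by omega))
  have hi : ∀ m, 1 ≤ m → m ≤ n → Φ (casimir (interval n 1 m)) = opInitial β m := by
    intro m hm hmn
    obtain ⟨m, rfl⟩ : ∃ t, m = t + 1 := ⟨m - 1, by omega⟩
    rw [hΦ, HalfShifts.sum_site_interval (p := 0) _ (by omega) hmn, HalfShifts.partialTotal,
      sub_zero, opCasimir_partialTotal]
  have hp : ∀ p q, 2 ≤ p → p ≤ q → q ≤ n →
      Φ (casimir (interval n p q)) = opInterval β p q := by
    intro p q h2 hpq hq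
    obtain ⟨l, rfl⟩ : ∃ l, p = l + 1 + 1 := ⟨p - 2, by omega⟩
    obtain ⟨j, rfl⟩ : ∃ j, q = l + j + 2 := ⟨q - l - 2, by omega⟩
    rw [hΦ, HalfShifts.sum_site_interval _ (by omega) hq, opCasimir_partialTotal_sub β (by omega)]
  refine ⟨Φ, hi, hp, le_antisymm ?_ ?_⟩
  · rw [Subalgebra.map_le]
    refine Algebra.adjoin_le ?_
    rintro _ ⟨K, -, rfl⟩
    refine casimir_mem_of_interval_mem ((discreteAlgebra n β).comap Φ)
      (fun p q h1 hpq hq => ?_) K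
    rw [Subalgebra.mem_comap]
    rcases Nat.lt_or_ge p 2 with h | h
    · obtain rfl : p = 1 := by omega
      rw [hi q hpq hq]
      exact Algebra.subset_adjoin (Or.inl ⟨q, hpq, hq, rfl⟩)
    · rw [hp p q h hpq hq]
      exact Algebra.subset_adjoin (Or.inr ⟨p, q, h, hpq, hq, rfl⟩)
  · refine Algebra.adjoin_le ?_
    rintro _ (⟨m, h1, hm, rfl⟩ | ⟨p, q, h2, hpq, hq, rfl⟩)
    · exact ⟨_, casimir_mem _, hi m h1 hm⟩
    · exact ⟨_, casimir_mem _, hp p q h2 hpq hq⟩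

end RacahRealization

end

theorem mainTheorem8 {k : Type*} [Field k] [CharZero k] (n : ℕ) (β : ℕ → k) :
    ∃ φ : RacahRealization.racahAlgebra k n →ₐ[k] Module.End k (RacahRealization.RatFun k),
      (∀ m, 1 ≤ m → m ≤ n →
        φ (RacahRealization.gen (RacahRealization.interval n 1 m)) =
          RacahRealization.opInitial β m) ∧
      (∀ p q, 2 ≤ p → p ≤ q → q ≤ n →
        φ (RacahRealization.gen (RacahRealization.interval n p q)) =
          RacahRealization.opInterval β p q) ∧
      φ.range = RacahRealization.discreteAlgebra n β ∧
      (∀ (s : ℕ → ℕ) (m : ℕ), 1 ≤ m → m + 1 ≤ n →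
        φ (RacahRealization.gen (RacahRealization.interval n 2 (m + 1)))
            (RacahRealization.multiRacah n (RacahRealization.xvar k)
              (RacahRealization.param β) s) =
          RacahRealization.kappa (RacahRealization.partialSum s (m - 1) : RacahRealization.RatFun k)
              (RacahRealization.param β m - RacahRealization.param β 0 - 1) *
            RacahRealization.multiRacah n (RacahRealization.xvar k)
              (RacahRealization.param β) s) := by
  obtain ⟨Φ, hi, hp, hr⟩ := RacahRealization.exists_realization n β
  have hint : ∀ p q, 2 ≤ p → p ≤ q → q ≤ n →
      (Φ.comp (RacahRealization.racahAlgebra k n).val)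
        (RacahRealization.gen (RacahRealization.interval n p q)) =
          RacahRealization.opInterval β p q := hp
  refine ⟨Φ.comp (RacahRealization.racahAlgebra k n).val, hi, hint, ?_, fun s m h1 hm => ?_⟩
  · rw [AlgHom.range_comp, Subalgebra.range_val, hr]
  · obtain ⟨j, rfl⟩ : ∃ j, m = j + 1 := ⟨m - 1, by omega⟩
    rw [hint 2 (j + 1 + 1) le_rfl (by omega) hm]
    exact RacahRealization.opInterval_multiRacah n β s hm
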